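/- Let $n,d\ge 1$, let $M\subset\mathbb{C}^{n+d}$ be a generic real submanifold of class $\mathcal{C}^2$ and of real codimension $d$, and let $p\in M$. Suppose that in suitable local holomorphic coordinates $(z,w)\in\mathbb{C}^n\times\mathbb{C}^d$ centred at $p$, $M$ is given near $p$ by $$\mathrm{Im}\,w_j={}^t\bar z A_j z+h_j(z,\mathrm{Re}\,w),\qquad j=1,\dots,d,$$ where $A_1,\dots,A_d$ are Hermitian matrices of size $n$, and $h=(h_1,\dots,h_d)$ is of class $\mathcal{C}^2$ near $0$ with $h(z,u)=o(|z|^2+|u|)$ as $(z,u)\to 0$. Let $T_pM$ be the tangent space, $N_pM$ its orthogonal complement in $T_p(\mathbb{R}^{2(n+d)})$, $\pi_p$ the orthogonal projection onto $N_pM$ and $J$ the standard complex structure (both $\mathbb{C}$-linearly extended to complexified spaces). Let $T^{(1,0)}_pM=\{Z\in\mathbb{C}\otimes T_pM : JZ=iZ\}$. The Levi map $L_p:T_p^{(1,0)}M\to N_pM$ is $$L_p(X_p)=\frac1{2i}\,\pi_p\bigl(J[\overline X,X](p)\bigr),$$ where $X$ is any local $\mathcal{C}^1$ section of $T^{(1,0)}M$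 near $p$ with $X(p)=X_p$. Then the following conditions are equivalent: (a) $A_1,\dots,A_d$ are linearly independent over $\mathbb{R}$ (equivalently, over $\mathbb{C}$); (1) the image of $L_p$ is not contained in a hyperplane of $N_pM$, that is, in a linear subspace of codimension one; (2) the Levi cone of $M$ at $p$, that is, the convex hull of the image of $L_p$, has nonempty interior in $N_pM$; equivalently, the linear hull of the image of $L_p$ has nonempty interior in $N_pM$; (3) $M$ is of finite type at $p$ with $2$ the only Hörmander number, that is, there are finitely many local $\mathcal{C}^1$ sections $L_1,\dots,L_m$ of $T^{(1,0)}M$ near $p$ such that the values at $p$ of $L_1,\dots,L_m,\overline{L_1},\dots,\overline{L_m}$ and of the Lie brackets of any two of these fields generate the complex vector space $\mathbb{C}\otimes T_pM$. Consequently (a) is a biholomorphic invariant: if $F$ is a biholomorphism from a neighbourhood of $p$ onto an open subset of $\mathbb{C}^{n+d}$, mapping $M$ near $p$ onto $M'$ near $F(p)$, where $M'\subset\mathbb{C}^{n+d}$ is a generic real $\mathcal{C}^2$ submanifold of codimension $d$, and if $M'$ has at $F(p)$ reduced equations as above with Hermitian matrices $A'_1,\dots,A'_d$, then $A_1,\dots,A_d$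 are linearly independent if and only if $A'_1,\dots,A'_d$ are. In particular (a) does not depend on the choice of the reduced equations. -/

import Mathlib

open Filter Topology Asymptotics
open scoped TensorProduct Matrix

noncomputable section

namespace LeviCR

/-- `ℂ^N`, whose underlying real Euclidean space is `ℝ^{2N}`; it is identified with each of its tangent spaces. -/
abbrev CSpace (N : ℕ) : Type := EuclideanSpace ℂ (Fin N)

/-- The complexified tangent space `ℂ ⊗ T_q(ℝ^{2N})`; the complex scalars act on the left factor. -/
abbrev CTangent (N : ℕ) : Type := ℂ ⊗[ℝ] CSpace N

variable {N : ℕ}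

/-- The standard complex structure `J` of `ℝ^{2N} = ℂ^N`, i.e. multiplication by `i`. -/
def J (N : ℕ) : CSpace N →ₗ[ℝ] CSpace N :=
  (LinearMap.lsmul ℂ (CSpace N) Complex.I).restrictScalars ℝ

/-- The tangent space `T_q M`, spanned by the velocities at `q` of curves contained in `M`. -/
def tangentSpace (M : Set (CSpace N)) (q : CSpace N) : Submodule ℝ (CSpace N) :=
  Submodule.span ℝ {v | ∃ γ : ℝ → CSpace N,
    γ 0 = q ∧ (∀ᶠ t in 𝓝 0, γ t ∈ M) ∧ HasDerivAt γ v 0}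

/-- The normal space `N_q M`, the orthogonal complement of `T_q M` in `ℝ^{2N}`. -/
def normalSpace (M : Set (CSpace N)) (q : CSpace N) : Submodule ℝ (CSpace N) :=
  (tangentSpace M q)ᗮ

/-- The orthogonal projection `π_q : ℝ^{2N} → N_q M`. -/
def normalProj (M : Set (CSpace N)) (q : CSpace N) : CSpace N →ₗ[ℝ] normalSpace M q :=
  ((normalSpace M q).orthogonalProjectionOnto : CSpace N →L[ℝ] normalSpace M q).toLinearMap

/-- `M` is a real submanifold of `ℂ^N` of class `C²` and of real codimension `d`. -/
def IsC2Submanifold (d : ℕ) (M : Set (CSpace N)) : Prop :=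
  ∀ q ∈ M, ∃ (U : Set (CSpace N)) (ρ : CSpace N → (Fin d → ℝ)),
    IsOpen U ∧ q ∈ U ∧ ContDiffOn ℝ 2 ρ U ∧ M ∩ U = {x ∈ U | ρ x = 0} ∧
      Function.Surjective (fderiv ℝ ρ q)

/-- `M` is generic: `T_q M + J T_q M = T_q ℂ^N` at every point `q` of `M`. -/
def IsGeneric (M : Set (CSpace N)) : Prop :=
  ∀ q ∈ M, tangentSpace M q ⊔ (tangentSpace M q).map (J N) = ⊤

/-- The space `T_q^{(1,0)} M`: the vectors `Z` of `ℂ ⊗ T_q M` with `J Z = i Z`. -/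
def holTangent (M : Set (CSpace N)) (q : CSpace N) : Submodule ℂ (CTangent N) :=
  (tangentSpace M q).baseChange ℂ ⊓
    LinearMap.ker ((J N).baseChange ℂ - Complex.I • LinearMap.id)

/-- A complex vector field `re + i im` on `ℂ^N`, where `re` and `im` are real vector fields. -/
structure CField (N : ℕ) where
  re : CSpace N → CSpace N
  im : CSpace N → CSpace N

namespace CField

/-- The value at `q`, in the complexified tangent space. -/
def eval (X : CField N) (q : CSpace N) : CTangent N :=
  (1 : ℂ) ⊗ₜ[ℝ] X.re q + Complex.I ⊗ₜ[ℝ] X.im q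

/-- The conjugate field. -/
def conj (X : CField N) : CField N where
  re := X.re
  im := fun q => -X.im q

/-- The Lie bracket, extended to complex fields by complex bilinearity. -/
def bracket (X Y : CField N) : CField N where
  re := fun q => VectorField.lieBracket ℝ X.re Y.re q - VectorField.lieBracket ℝ X.im Y.im q
  im := fun q => VectorField.lieBracket ℝ X.re Y.im q + VectorField.lieBracket ℝ X.im Y.re q

end CField

/-- `X` is a `C¹` section of `T^{(1,0)} M` near `p`, extended to a `C¹` field on a neighbourhood of `p` in `ℂ^N`.
Brackets at `p` of such fields and of their conjugates only depend on the restrictions to `M`,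
the fields being tangent to `M`. -/
def IsHolField (M : Set (CSpace N)) (p : CSpace N) (X : CField N) : Prop :=
  ContDiffAt ℝ 1 X.re p ∧ ContDiffAt ℝ 1 X.im p ∧ ∀ᶠ q in 𝓝[M] p, X.eval q ∈ holTangent M q

/-- `η = (1/2i) π_p (J [X̄, X](p))` for some local section `X` of `T^{(1,0)} M` with `X(p) = Z`. -/
def IsLeviValue (M : Set (CSpace N)) (p : CSpace N) (Z : CTangent N) (η : normalSpace M p) : Prop :=
  ∃ X : CField N, IsHolField M p X ∧ X.eval p = Z ∧
    (1 : ℂ) ⊗ₜ[ℝ] η = (1 / (2 * Complex.I)) •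
      (normalProj M p).baseChange ℂ ((J N).baseChange ℂ ((X.conj.bracket X).eval p))

open Classical in
/-- The Levi map `L_p : T_p^{(1,0)} M → N_p M`. For a `C²` CR submanifold the vector `(1/2i) π_p (J [X̄, X](p))` is
real and depends only on `X(p)`, so that there is exactly one value to choose. -/
def leviMap (M : Set (CSpace N)) (p : CSpace N) (Z : holTangent M p) : normalSpace M p :=
  if h : ∃ η, IsLeviValue M p (Z : CTangent N) η then h.choose else 0

/-- `M` is of finite type at `p` with `2` the only Hörmander number: for some sections `L_1, …, L_m` of `T^{(1,0)} M`
near `p`, the values at `p` of the `L_i`, of the conjugates `L̄_i` and of the Lie brackets of any two of these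
fields generate `ℂ ⊗ T_p M`. -/
def IsFiniteTypeTwo (M : Set (CSpace N)) (p : CSpace N) : Prop :=
  ∃ (m : ℕ) (L : Fin m → CField N), (∀ i, IsHolField M p (L i)) ∧
    ∃ S : Set (CField N), S = Set.range L ∪ Set.range (fun i => (L i).conj) ∧
      Submodule.span ℂ ({Z | ∃ X ∈ S, Z = X.eval p} ∪
          {Z | ∃ X ∈ S, ∃ Y ∈ S, Z = (X.bracket Y).eval p}) =
        (tangentSpace M p).baseChange ℂ

/-- `Φ` is a biholomorphism between its (open) source and target. -/
def IsBiholomorphism {E F : Type*} [NormedAddCommGroup E] [NormedSpace ℂ E]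
    [NormedAddCommGroup F] [NormedSpace ℂ F] (Φ : OpenPartialHomeomorph E F) : Prop :=
  DifferentiableOn ℂ Φ Φ.source ∧ DifferentiableOn ℂ Φ.symm Φ.target

/-- In suitable local holomorphic coordinates `(z, w) ∈ ℂ^n × ℂ^d` centred at `p`, `M` has the reduced equations
`Im w_j = ᵗz̄ A_j z + h_j(z, Re w)`, `A_j` Hermitian, `h` of class `C²`, `h = o(|z|² + |Re w|)`. -/
def HasReducedEquation {n d : ℕ} (M : Set (CSpace N)) (p : CSpace N)
    (A : Fin d → Matrix (Fin n) (Fin n) ℂ) : Prop :=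
  (∀ j, (A j).IsHermitian) ∧
  ∃ (Φ : OpenPartialHomeomorph (CSpace N) ((Fin n → ℂ) × (Fin d → ℂ)))
    (h : (Fin n → ℂ) × (Fin d → ℝ) → (Fin d → ℝ)),
    IsBiholomorphism Φ ∧ p ∈ Φ.source ∧ Φ p = 0 ∧
    ContDiffAt ℝ 2 h 0 ∧
    h =o[𝓝 0] (fun x : (Fin n → ℂ) × (Fin d → ℝ) => ‖x.1‖ ^ 2 + ‖x.2‖) ∧
    ∀ᶠ q in 𝓝 p, (q ∈ M ↔ ∀ j : Fin d,
      (((Φ q).2 j).im : ℂ) =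
        star (Φ q).1 ⬝ᵥ (A j *ᵥ (Φ q).1) + (h ((Φ q).1, fun k => ((Φ q).2 k).re) j : ℂ))

end LeviCR

end

/-! ### Cauchy estimates and smoothness of complex differentiable maps in several variables. -/

section Osgood

variable {E F : Type*} [NormedAddCommGroup E] [NormedSpace ℂ E] [NormedAddCommGroup F]
  [NormedSpace ℂ F]

/-! Let ρ be a C² defining function of M near p and H the largest complex subspace of ker dρ at p.
Differentiating dρ(W) = 0 and dρ(JW) = 0 along M, for a field W with values in the complex tangent
spaces, gives dρ(J[V,W]) = -L(V, JW) at p, where L(v,w) = D²ρ(v,w) + D²ρ(Jv,Jw)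
(`fderiv_I_smul_lieBracket`). No derivative of the fields survives. Since dρ identifies the normal
space with ℝ^d, the Levi map becomes v ↦ -L(v,v) on H (`normalEquiv_leviMap`).

For ρ read off from reduced equations, the part of D²ρ coming from the holomorphic chart cancels in
L, and the remainder h has no second order term in the z directions. The image of the Levi map thus
becomes the set of vectors 4(ᵗz̄ A_j z)_j (`HasReducedEquation.exists_isGenericDefining`). A real
functional g kills this set exactly when ∑ g_j A_j has zero quadratic form, that is, vanishes. So
the image spans iff the A_j are independent (`span_range_hermValue_eq_top_iff`).

Conditions (1) and (2) rephrase this spanning; the convex hull is covered because 0 is a Levi value.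
For (3), brackets of sections and their conjugates leave the complex tangent space only in
directions measured by the values of L, and fields extending a basis of H reach all of these
(`isFiniteTypeTwo_iff`). For invariance, reduced equations of M' pull back to reduced equations of M
with the same matrices, while the span of the Levi map involves only M and p. -/

theorem hasDerivAt_comp_add_smul {f : E → F} {x v : E} {ζ : ℂ}
    (hf : DifferentiableAt ℂ f (x + ζ • v)) :
    HasDerivAt (fun ζ : ℂ => f (x + ζ • v)) (fderiv ℂ f (x + ζ • v) v) ζ := by
  have h : HasDerivAt (fun ζ : ℂ => x + ζ • v) v ζ := by
    simpa using ((hasDerivAt_id ζ).smul_const v).const_add x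
  exact hf.hasFDerivAt.comp_hasDerivAt ζ h

/-- Cauchy's estimate for the Fréchet derivative. -/
theorem norm_fderiv_le_of_forall_mem_closedBall {f : E → F} {x : E} {r C : ℝ} (hr : 0 < r)
    (hC : 0 ≤ C) (hf : ∀ y ∈ Metric.closedBall x r, DifferentiableAt ℂ f y)
    (hb : ∀ y ∈ Metric.closedBall x r, ‖f y‖ ≤ C) : ‖fderiv ℂ f x‖ ≤ C / r := by
  let _ : NormedSpace ℝ E := NormedSpace.restrictScalars ℝ ℂ E
  refine ContinuousLinearMap.opNorm_le_of_unit_norm (by positivity) fun v hv => ?_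
  have hmem : ∀ ζ ∈ Metric.closedBall (0 : ℂ) r, x + ζ • v ∈ Metric.closedBall x r := by
    intro ζ hζ
    simpa [norm_smul, hv] using hζ
  have hd : ∀ ζ ∈ Metric.closedBall (0 : ℂ) r,
      HasDerivAt (fun ζ : ℂ => f (x + ζ • v)) (fderiv ℂ f (x + ζ • v) v) ζ :=
    fun ζ hζ => hasDerivAt_comp_add_smul (hf _ (hmem ζ hζ))
  have h0 := (hd 0 (Metric.mem_closedBall_self hr.le)).deriv
  rw [zero_smul, add_zero] at h0
  rw [← h0]
  refine Complex.norm_deriv_le_of_forall_mem_sphere_norm_le hr ?_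
    fun ζ hζ => hb _ (hmem ζ (Metric.sphere_subset_closedBall hζ))
  refine DifferentiableOn.diffContOnCl_ball (U := Metric.closedBall 0 r) (fun ζ hζ => ?_) subset_rfl
  exact (hd ζ hζ).differentiableAt.differentiableWithinAt

/-- Cauchy's estimate is applied to the difference of f and its translate by y - x, which is
uniformly small by uniform continuity of f on a compact ball. -/
theorem continuousOn_fderiv_of_differentiableOn [FiniteDimensional ℂ E] {f : E → F} {U : Set E}
    (hU : IsOpen U) (hf : DifferentiableOn ℂ f U) : ContinuousOn (fderiv ℂ f) U := by
  have := FiniteDimensional.proper ℂ E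
  intro x hx
  refine ContinuousAt.continuousWithinAt ?_
  obtain ⟨R, hR, hRU⟩ := Metric.nhds_basis_closedBall.mem_iff.1 (hU.mem_nhds hx)
  have huc := (isCompact_closedBall x R).uniformContinuousOn_of_continuous
    (hf.continuousOn.mono hRU)
  have hdiff : ∀ y ∈ Metric.closedBall x R, DifferentiableAt ℂ f y :=
    fun y hy => (hf y (hRU hy)).differentiableAt (hU.mem_nhds (hRU hy))
  rw [Metric.continuousAt_iff]
  intro ε hε
  rw [Metric.uniformContinuousOn_iff] at huc
  obtain ⟨δ, hδ, H⟩ := huc (ε * (R / 2) / 2) (by positivity)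
  refine ⟨min δ (R / 2), by positivity, fun {y} hy => ?_⟩
  have hyδ : ‖y - x‖ < δ := by simpa [dist_eq_norm] using hy.trans_le (min_le_left _ _)
  have hyR : ‖y - x‖ < R / 2 := by simpa [dist_eq_norm] using hy.trans_le (min_le_right _ _)
  have hmem : ∀ z ∈ Metric.closedBall x (R / 2), z ∈ Metric.closedBall x R ∧
      z + (y - x) ∈ Metric.closedBall x R := by
    intro z hz
    rw [mem_closedBall_iff_norm] at hz
    constructor
    · rw [mem_closedBall_iff_norm]; linarith
    · rw [mem_closedBall_iff_norm]
      calc ‖z + (y - x) - x‖ = ‖(z - x) + (y - x)‖ := by congr 1; abel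
        _ ≤ ‖z - x‖ + ‖y - x‖ := norm_add_le _ _
        _ ≤ R := by linarith
  have hshift : ∀ z ∈ Metric.closedBall x (R / 2),
      HasFDerivAt (fun z => f (z + (y - x))) (fderiv ℂ f (z + (y - x))) z := fun z hz =>
    (hdiff _ (hmem z hz).2).hasFDerivAt.comp z ((hasFDerivAt_id z).add_const _)
  have hle := norm_fderiv_le_of_forall_mem_closedBall (f := fun z => f (z + (y - x)) - f z)
    (x := x) (r := R / 2) (C := ε * (R / 2) / 2) (by positivity) (by positivity)
    (fun z hz => (hshift z hz).differentiableAt.sub (hdiff z (hmem z hz).1))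
    (fun z hz => by
      rw [← dist_eq_norm]
      refine (H _ (hmem z hz).2 _ (hmem z hz).1 ?_).le
      simpa [dist_eq_norm] using hyδ)
  have hx2 : x ∈ Metric.closedBall x (R / 2) := Metric.mem_closedBall_self (by positivity)
  have he : fderiv ℂ (fun z => f (z + (y - x)) - f z) x = fderiv ℂ f y - fderiv ℂ f x := by
    have h1 := ((hshift x hx2).sub (hdiff x (hmem x hx2).1).hasFDerivAt).fderiv
    rw [add_sub_cancel] at h1
    exact h1
  rw [he] at hle
  rw [dist_eq_norm]
  refine hle.trans_lt ?_
  rw [mul_div_right_comm, mul_div_cancel_right₀ _ (by positivity : R / 2 ≠ 0)]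
  linarith

/-- Cauchy's formula on the complex line through y in direction v writes the directional derivative
as a circle integral of f. The integral can be differentiated in y because the derivative of f is
already known to be continuous, hence bounded on a compact ball. -/
theorem differentiableOn_fderiv_apply [FiniteDimensional ℂ E] [CompleteSpace F] {f : E → F}
    {U : Set E} (hU : IsOpen U) (hf : DifferentiableOn ℂ f U) (v : E) :
    DifferentiableOn ℂ (fun x => fderiv ℂ f x v) U := by
  have := FiniteDimensional.proper ℂ E
  intro x hx
  refine DifferentiableAt.differentiableWithinAt ?_
  obtain ⟨R, hR, hRU⟩ := Metric.nhds_basis_closedBall.mem_iff.1 (hU.mem_nhds hx)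
  have hdiff : ∀ y ∈ Metric.closedBall x R, DifferentiableAt ℂ f y :=
    fun y hy => (hf y (hRU hy)).differentiableAt (hU.mem_nhds (hRU hy))
  have hDc := (continuousOn_fderiv_of_differentiableOn hU hf).mono hRU
  obtain ⟨K, hK⟩ := (isCompact_closedBall x R).exists_bound_of_continuousOn hDc
  -- This radius keeps y + ζv in the ball of radius R whenever y is in the half ball; the added 1
  -- covers v = 0.
  set r : ℝ := R / (2 * (‖v‖ + 1)) with hr
  have hv : 0 ≤ ‖v‖ := norm_nonneg v
  have hrpos : 0 < r := by positivity
  have hrv : r * ‖v‖ ≤ R / 2 := by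
    rw [hr, div_mul_eq_mul_div, div_le_div_iff₀ (by positivity) (by positivity)]
    nlinarith
  have hmem : ∀ y ∈ Metric.ball x (R / 2), ∀ ζ ∈ Metric.closedBall (0 : ℂ) r,
      y + ζ • v ∈ Metric.closedBall x R := by
    intro y hy ζ hζ
    rw [mem_ball_iff_norm] at hy
    rw [mem_closedBall_zero_iff] at hζ
    rw [mem_closedBall_iff_norm]
    calc ‖y + ζ • v - x‖ = ‖(y - x) + ζ • v‖ := by congr 1; abel
      _ ≤ ‖y - x‖ + ‖ζ • v‖ := norm_add_le _ _
      _ ≤ R / 2 + r * ‖v‖ := by rw [norm_smul]; gcongr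
      _ ≤ R := by linarith
  have hcm : ∀ θ : ℝ, circleMap 0 r θ ∈ Metric.closedBall (0 : ℂ) r := fun θ =>
    circleMap_mem_closedBall 0 hrpos.le θ
  have hcauchy : ∀ y ∈ Metric.ball x (R / 2), fderiv ℂ f y v =
      (2 * Real.pi * Complex.I : ℂ)⁻¹ • ∮ ζ in C(0, r), ((ζ - 0) ^ 2)⁻¹ • f (y + ζ • v) := by
    intro y hy
    have hopen : IsOpen {ζ : ℂ | y + ζ • v ∈ U} := hU.preimage (by fun_prop)
    have hder : ∀ ζ ∈ {ζ : ℂ | y + ζ • v ∈ U}, HasDerivAt (fun ζ : ℂ => f (y + ζ • v))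
        (fderiv ℂ f (y + ζ • v) v) ζ := fun ζ hζ =>
      hasDerivAt_comp_add_smul ((hf _ hζ).differentiableAt (hU.mem_nhds hζ))
    rw [Complex.two_pi_I_inv_smul_circleIntegral_sub_sq_inv_smul_of_differentiable hopen
      (fun ζ hζ => hRU (hmem y hy ζ hζ))
      (fun ζ hζ => (hder ζ hζ).differentiableAt.differentiableWithinAt)
      (Metric.mem_ball_self hrpos)]
    have := (hder 0 (hRU (hmem y hy 0 (Metric.mem_closedBall_self hrpos.le)))).deriv
    rw [this]; simp
  set c : ℝ → ℂ := fun θ => deriv (circleMap 0 r) θ * ((circleMap 0 r θ - 0) ^ 2)⁻¹ with hc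
  have hcc : Continuous c := by
    have h1 : Continuous (deriv (circleMap 0 r)) := by
      have : deriv (circleMap 0 r) = fun θ => circleMap 0 r θ * Complex.I := by
        ext θ; simp
      rw [this]; fun_prop
    refine h1.mul (Continuous.inv₀ (by fun_prop) fun θ => ?_)
    simpa using hrpos.ne'
  have hxb : x ∈ Metric.ball x (R / 2) := Metric.mem_ball_self (by positivity)
  have hcont : ∀ y ∈ Metric.ball x (R / 2), Continuous fun θ => c θ • f (y + circleMap 0 r θ • v) := by
    intro y hy
    exact hcc.smul ((hf.continuousOn.mono hRU).comp_continuous (by fun_prop)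
      fun θ => hmem y hy _ (hcm θ))
  have hcont' : Continuous fun θ => c θ • fderiv ℂ f (x + circleMap 0 r θ • v) :=
    hcc.smul (hDc.comp_continuous (by fun_prop) fun θ => hmem x hxb _ (hcm θ))
  have key := intervalIntegral.hasFDerivAt_integral_of_dominated_of_fderiv_le (𝕜 := ℂ)
    (μ := MeasureTheory.volume) (a := 0) (b := 2 * Real.pi) (s := Metric.ball x (R / 2))
    (F := fun y θ => c θ • f (y + circleMap 0 r θ • v))
    (F' := fun y θ => c θ • fderiv ℂ f (y + circleMap 0 r θ • v))
    (bound := fun θ => ‖c θ‖ * K) (x₀ := x)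
    (Metric.ball_mem_nhds x (by positivity))
    (by
      filter_upwards [Metric.ball_mem_nhds x (half_pos hR)] with y hy
      exact (hcont y hy).aestronglyMeasurable)
    ((hcont x hxb).intervalIntegrable _ _)
    hcont'.aestronglyMeasurable
    (Eventually.of_forall fun θ _ y hy => by
      rw [norm_smul]
      gcongr
      exact hK _ (hmem y hy _ (hcm θ)))
    ((hcc.norm.mul continuous_const).intervalIntegrable _ _)
    (Eventually.of_forall fun θ _ y hy => by
      refine HasFDerivAt.const_smul ?_ _
      exact (hdiff _ (hmem y hy _ (hcm θ))).hasFDerivAt.comp y ((hasFDerivAt_id y).add_const _))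
  refine (key.differentiableAt.const_smul ((2 * Real.pi * Complex.I : ℂ)⁻¹)).congr_of_eventuallyEq ?_
  filter_upwards [Metric.ball_mem_nhds x (half_pos hR)] with y hy
  simp only [hcauchy y hy, circleIntegral, hc, smul_smul, Pi.smul_apply]

/-- A Fréchet differentiable function on an open set of a finite dimensional complex space is
smooth. -/
theorem contDiffOn_of_differentiableOn_complex [FiniteDimensional ℂ E] [CompleteSpace F]
    {U : Set E} (hU : IsOpen U) (n : ℕ) :
    ∀ {f : E → F}, DifferentiableOn ℂ f U → ContDiffOn ℂ n f U := by
  induction n with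
  | zero => exact fun hf => contDiffOn_zero.2 hf.continuousOn
  | succ n ih =>
    intro f hf
    rw [Nat.cast_succ, contDiffOn_succ_iff_fderiv_of_isOpen hU]
    exact ⟨hf, fun h => absurd h (by simp), contDiffOn_clm_apply.2 fun v =>
      ih (differentiableOn_fderiv_apply hU hf v)⟩

end Osgood

/-! ### Complexified real vector spaces in the normal form a + ib. -/

noncomputable section
namespace LeviCR
section Complexification

variable {V W : Type*} [AddCommGroup V] [Module ℝ V] [AddCommGroup W] [Module ℝ W]

/-- The element `a + i b` of the complexification. -/
def complexify (a b : V) : ℂ ⊗[ℝ] V := (1 : ℂ) ⊗ₜ[ℝ] a + Complex.I ⊗ₜ[ℝ] b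

theorem complexify_inj {a b a' b' : V} :
    complexify a b = complexify a' b' ↔ a = a' ∧ b = b' := by
  refine ⟨fun h => ?_, by rintro ⟨rfl, rfl⟩; rfl⟩
  have hre := congrArg (TensorProduct.lift ((LinearMap.lsmul ℝ V) ∘ₗ Complex.reLm)) h
  have him := congrArg (TensorProduct.lift ((LinearMap.lsmul ℝ V) ∘ₗ Complex.imLm)) h
  simp [complexify] at hre him
  exact ⟨hre, him⟩

theorem smul_complexify (c : ℂ) (a b : V) :
    c • complexify a b = complexify (c.re • a - c.im • b) (c.im • a + c.re • b) := by
  have h : ∀ (z : ℂ) (x : V), z ⊗ₜ[ℝ] x = (1 : ℂ) ⊗ₜ[ℝ] (z.re • x) + Complex.I ⊗ₜ[ℝ] (z.im • x) := by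
    intro z x
    rw [← TensorProduct.smul_tmul, ← TensorProduct.smul_tmul, ← TensorProduct.add_tmul]
    congr 1
    apply Complex.ext <;> simp
  simp only [complexify, smul_add, TensorProduct.smul_tmul', smul_eq_mul, mul_one]
  rw [h c a, h (c * Complex.I) b]
  simp only [Complex.mul_re, Complex.mul_im, Complex.I_re, Complex.I_im, TensorProduct.tmul_sub,
    TensorProduct.tmul_add]
  simp only [mul_zero, mul_one, zero_sub, add_zero, neg_smul, TensorProduct.tmul_neg]
  abel

theorem complexify_add (a b a' b' : V) :
    complexify a b + complexify a' b' = complexify (a + a') (b + b') := by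
  simp only [complexify, TensorProduct.tmul_add]
  abel

theorem exists_complexify_eq (Z : ℂ ⊗[ℝ] V) : ∃ a b, Z = complexify a b := by
  induction Z with
  | zero => exact ⟨0, 0, by simp [complexify]⟩
  | tmul c x =>
    refine ⟨c.re • x, c.im • x, ?_⟩
    have := smul_complexify c x 0
    simp only [smul_zero, sub_zero, add_zero] at this
    rw [← this]
    simp [complexify, TensorProduct.smul_tmul']
  | add x y hx hy =>
    obtain ⟨a, b, rfl⟩ := hx
    obtain ⟨a', b', rfl⟩ := hy
    exact ⟨_, _, complexify_add a b a' b'⟩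

theorem baseChange_complexify (f : V →ₗ[ℝ] W) (a b : V) :
    f.baseChange ℂ (complexify a b) = complexify (f a) (f b) := by
  simp [complexify]

theorem complexify_mem_baseChange {S : Submodule ℝ V} {a b : V} :
    complexify a b ∈ S.baseChange ℂ ↔ a ∈ S ∧ b ∈ S := by
  constructor
  · intro h
    obtain ⟨y, hy⟩ := h
    obtain ⟨a', b', rfl⟩ := exists_complexify_eq y
    have h2 : complexify (a' : V) (b' : V) = complexify a b := by
      rw [← hy]; simp [complexify]
    obtain ⟨rfl, rfl⟩ := complexify_inj.1 h2
    exact ⟨a'.2, b'.2⟩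
  · rintro ⟨ha, hb⟩
    exact add_mem (Submodule.tmul_mem_baseChange_of_mem _ ha)
      (Submodule.tmul_mem_baseChange_of_mem _ hb)

theorem baseChange_le_of_one_tmul_mem {S : Submodule ℝ V} {P : Submodule ℂ (ℂ ⊗[ℝ] V)}
    (h : ∀ a ∈ S, (1 : ℂ) ⊗ₜ[ℝ] a ∈ P) : S.baseChange ℂ ≤ P := by
  rw [Submodule.baseChange_eq_span, Submodule.span_le]
  rintro _ ⟨a, ha, rfl⟩
  exact h a ha

end Complexification

/-! ### Tangent spaces and (1,0) vectors. -/

section Tangent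
variable {N : ℕ}

theorem CField.eval_eq (X : CField N) (q : CSpace N) :
    X.eval q = complexify (X.re q) (X.im q) := rfl

theorem J_apply (v : CSpace N) : J N v = Complex.I • v := rfl

theorem I_smul_I_smul (v : CSpace N) : Complex.I • Complex.I • v = -v := by
  rw [smul_smul, Complex.I_mul_I, neg_one_smul]

/-- Comparing real and imaginary parts in JZ = iZ forces b = -Ja, so a (1,0) vector is determined by
its real part. -/
theorem complexify_mem_holTangent {M : Set (CSpace N)} {q a b : CSpace N} :
    complexify a b ∈ holTangent M q ↔
      a ∈ tangentSpace M q ∧ Complex.I • a ∈ tangentSpace M q ∧ b = -(Complex.I • a) := by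
  have h : complexify a b ∈ LinearMap.ker ((J N).baseChange ℂ - Complex.I • LinearMap.id) ↔
      b = -(Complex.I • a) := by
    rw [LinearMap.mem_ker, LinearMap.sub_apply, sub_eq_zero, LinearMap.smul_apply,
      LinearMap.id_apply, baseChange_complexify, smul_complexify, complexify_inj]
    simp only [J_apply, Complex.I_re, Complex.I_im, zero_smul, one_smul, zero_sub, add_zero]
    constructor
    · rintro ⟨h1, -⟩
      rw [h1, neg_neg]
    · rintro rfl
      simp [I_smul_I_smul]
  rw [holTangent, Submodule.mem_inf, h, complexify_mem_baseChange]
  constructor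
  · rintro ⟨⟨h1, h2⟩, rfl⟩
    exact ⟨h1, by simpa using h2, rfl⟩
  · rintro ⟨h1, h2, rfl⟩
    exact ⟨⟨h1, by simpa using h2⟩, rfl⟩

variable {F : Type*} [NormedAddCommGroup F] [NormedSpace ℝ F]

/-- The derivative of a function vanishing on `M` vanishes on the tangent space. -/
theorem fderiv_eq_zero_of_mem_tangentSpace {M : Set (CSpace N)} {q : CSpace N}
    {f : CSpace N → F} (hq : q ∈ M) (hf : DifferentiableAt ℝ f q) (h0 : ∀ᶠ x in 𝓝[M] q, f x = 0)
    {v : CSpace N} (hv : v ∈ tangentSpace M q) : fderiv ℝ f q v = 0 := by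
  suffices tangentSpace M q ≤ LinearMap.ker (fderiv ℝ f q).toLinearMap from this hv
  rw [tangentSpace, Submodule.span_le]
  rintro v ⟨γ, rfl, hγM, hγ⟩
  have h1 : HasDerivAt (f ∘ γ) (fderiv ℝ f (γ 0) v) 0 := hf.hasFDerivAt.comp_hasDerivAt 0 hγ
  have h2 : f ∘ γ =ᶠ[𝓝 0] fun _ => 0 := by
    have ht : Tendsto γ (𝓝 0) (𝓝[M] (γ 0)) :=
      tendsto_nhdsWithin_iff.2 ⟨hγ.continuousAt, hγM⟩
    exact ht.eventually h0
  exact h1.unique ((hasDerivAt_const (0 : ℝ) (0 : F)).congr_of_eventuallyEq h2)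

/-- The tangent space of a regular zero set is the kernel of the derivative. -/
theorem tangentSpace_eq_ker [CompleteSpace F] [FiniteDimensional ℝ F] {M : Set (CSpace N)}
    {q : CSpace N} {f : CSpace N → F}
    (hq : q ∈ M) (hf : ContDiffAt ℝ 1 f q) (hs : Function.Surjective (fderiv ℝ f q))
    (hM : ∀ᶠ x in 𝓝 q, x ∈ M ↔ f x = 0) :
    tangentSpace M q = LinearMap.ker (fderiv ℝ f q).toLinearMap := by
  have hfd : DifferentiableAt ℝ f q := hf.differentiableAt one_ne_zero
  refine le_antisymm (fun v hv => ?_) fun v hv => ?_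
  · refine fderiv_eq_zero_of_mem_tangentSpace hq hfd ?_ hv
    filter_upwards [nhdsWithin_le_nhds hM, self_mem_nhdsWithin] with x hx hxM using hx.1 hxM
  · have hsf : HasStrictFDerivAt f (fderiv ℝ f q) q := hf.hasStrictFDerivAt one_ne_zero
    have hr : (fderiv ℝ f q).range = ⊤ := LinearMap.range_eq_top.2 hs
    have hfq : f q = 0 := hM.self_of_nhds.1 hq
    -- The implicit function parametrizes the level set by the kernel, with derivative at 0 the
    -- inclusion; the image of the line through v is a curve in M with velocity v.
    set g := hsf.implicitFunction f (fderiv ℝ f q) hr (f q) with hg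
    have hpt : g 0 = q := hsf.implicitFunction_apply_image hr
    set w : (fderiv ℝ f q).ker := ⟨v, hv⟩ with hw
    have hlin : HasDerivAt (fun t : ℝ => t • w) w 0 := by
      simpa using (hasDerivAt_id (0 : ℝ)).smul_const w
    have hder : HasDerivAt (fun t : ℝ => g (t • w)) v 0 :=
      (hsf.to_implicitFunction hr).hasFDerivAt.comp_hasDerivAt_of_eq 0 hlin (zero_smul ℝ w).symm
    refine Submodule.subset_span ⟨fun t => g (t • w), by simpa using hpt, ?_, hder⟩
    have ht : Tendsto (fun t : ℝ => g (t • w)) (𝓝 0) (𝓝 q) := by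
      simpa [hpt] using hder.continuousAt.tendsto
    have ht2 : Tendsto (fun t : ℝ => (f q, t • w)) (𝓝 0) (𝓝 (f q, 0)) := by
      refine tendsto_const_nhds.prodMk_nhds ?_
      simpa using hlin.continuousAt.tendsto
    filter_upwards [ht.eventually hM, ht2.eventually (hsf.map_implicitFunction_eq hr)]
      with t h1 h2
    rw [h1, h2, hfq]

end Tangent
end LeviCR
end

/-! ### Generic defining functions and complex tangent fields. -/

noncomputable section
namespace LeviCR
section Defining

variable {N : ℕ} {F : Type*} [NormedAddCommGroup F] [NormedSpace ℝ F]

/-- Near `p`, the set `M` is the zero set of the `C²` map `ρ`, which defines a generic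
submanifold. -/
structure IsGenericDefining (M : Set (CSpace N)) (p : CSpace N) (ρ : CSpace N → F) : Prop where
  mem : p ∈ M
  contDiffAt : ContDiffAt ℝ 2 ρ p
  mem_iff : ∀ᶠ x in 𝓝 p, x ∈ M ↔ ρ x = 0
  surjective : Function.Surjective
    fun v => (fderiv ℝ ρ p v, fderiv ℝ ρ p (Complex.I • v))

/-- The largest complex subspace of the kernel of the derivative of `ρ` at `q`. -/
def complexKer (ρ : CSpace N → F) (q : CSpace N) : Submodule ℝ (CSpace N) :=
  LinearMap.ker (fderiv ℝ ρ q).toLinearMap ⊓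
    (LinearMap.ker (fderiv ℝ ρ q).toLinearMap).comap (J N)

theorem mem_complexKer {ρ : CSpace N → F} {q v : CSpace N} :
    v ∈ complexKer ρ q ↔ fderiv ℝ ρ q v = 0 ∧ fderiv ℝ ρ q (Complex.I • v) = 0 := Iff.rfl

theorem I_smul_mem_complexKer {ρ : CSpace N → F} {q v : CSpace N} (h : v ∈ complexKer ρ q) :
    Complex.I • v ∈ complexKer ρ q := by
  rw [mem_complexKer] at h ⊢
  exact ⟨h.2, by rw [I_smul_I_smul, map_neg, h.1, neg_zero]⟩

/-- The symmetrization under `J` of the second derivative of `ρ`. -/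
def leviForm (ρ : CSpace N → F) (p : CSpace N) : CSpace N →ₗ[ℝ] CSpace N →ₗ[ℝ] F :=
  LinearMap.mk₂ ℝ (fun v w => fderiv ℝ (fderiv ℝ ρ) p v w +
      fderiv ℝ (fderiv ℝ ρ) p (Complex.I • v) (Complex.I • w))
    (fun v v' w => by simp only [smul_add, map_add, add_apply]; abel)
    (fun c v w => by simp only [smul_comm Complex.I c, map_smul, smul_apply, smul_add])
    (fun v w w' => by simp only [smul_add, map_add]; abel)
    (fun c v w => by simp only [smul_comm Complex.I c, map_smul, smul_add])

theorem leviForm_apply (ρ : CSpace N → F) (p v w : CSpace N) :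
    leviForm ρ p v w = fderiv ℝ (fderiv ℝ ρ) p v w +
      fderiv ℝ (fderiv ℝ ρ) p (Complex.I • v) (Complex.I • w) := rfl

/-- The pair of real linear maps `(dρ, dρ ∘ J)`. -/
def derivPair (ρ : CSpace N → F) (q : CSpace N) : CSpace N →L[ℝ] F × F :=
  (fderiv ℝ ρ q).prod (fderiv ℝ ρ q ∘L (Complex.I • ContinuousLinearMap.id ℝ (CSpace N)))

theorem derivPair_apply (ρ : CSpace N → F) (q v : CSpace N) :
    derivPair ρ q v = (fderiv ℝ ρ q v, fderiv ℝ ρ q (Complex.I • v)) := rfl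

theorem derivPair_eq_zero_iff {ρ : CSpace N → F} {q v : CSpace N} :
    derivPair ρ q v = 0 ↔ v ∈ complexKer ρ q := by
  rw [derivPair_apply, mem_complexKer, Prod.mk_eq_zero]

/-- `V` is a `C¹` real vector field with values in the complex tangent space along `M`. -/
def IsComplexTangentField (M : Set (CSpace N)) (p : CSpace N) (ρ : CSpace N → F)
    (V : CSpace N → CSpace N) : Prop :=
  ContDiffAt ℝ 1 V p ∧ ∀ᶠ q in 𝓝[M] p, V q ∈ complexKer ρ q

namespace IsGenericDefining

variable {M : Set (CSpace N)} {p : CSpace N} {ρ : CSpace N → F}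

theorem surjective_derivPair (h : IsGenericDefining M p ρ) :
    Function.Surjective (derivPair ρ p) := h.surjective

theorem contDiffAt_fderiv (h : IsGenericDefining M p ρ) : ContDiffAt ℝ 1 (fderiv ℝ ρ) p :=
  h.contDiffAt.fderiv_right (by norm_num)

theorem contDiffAt_derivPair (h : IsGenericDefining M p ρ) : ContDiffAt ℝ 1 (derivPair ρ) p := by
  have hd := h.contDiffAt_fderiv
  exact (ContinuousLinearMap.prodₗᵢ (𝕜 := ℝ) (E := CSpace N) (F := F) (G := F)
    ℝ).toContinuousLinearEquiv.contDiff.contDiffAt.comp p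
      (hd.prodMk (hd.clm_comp contDiffAt_const))

variable [FiniteDimensional ℝ F]

theorem exists_rightInverse (h : IsGenericDefining M p ρ) :
    ∃ R : F × F →L[ℝ] CSpace N, derivPair ρ p ∘L R = 1 :=
  (derivPair ρ p).exists_rightInverse_of_surjective
    (LinearMap.range_eq_top.2 h.surjective_derivPair)

/-- Units form an open set. Hence genericity at p persists nearby, with a right inverse of
`derivPair` that varies with q. -/
theorem eventually_isUnit (h : IsGenericDefining M p ρ) {R : F × F →L[ℝ] CSpace N}
    (hR : derivPair ρ p ∘L R = 1) : ∀ᶠ q in 𝓝 p, IsUnit (derivPair ρ q ∘L R) := by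
  have : CompleteSpace F := FiniteDimensional.complete ℝ F
  have hc : ContinuousAt (fun q => derivPair ρ q ∘L R) p :=
    h.contDiffAt_derivPair.continuousAt.clm_comp continuousAt_const
  refine hc.eventually (Units.isOpen.mem_nhds ?_)
  simp [hR]

theorem eventually_tangentSpace_eq (h : IsGenericDefining M p ρ) :
    ∀ᶠ q in 𝓝 p, q ∈ M → tangentSpace M q = LinearMap.ker (fderiv ℝ ρ q).toLinearMap := by
  have : CompleteSpace F := FiniteDimensional.complete ℝ F
  obtain ⟨R, hR⟩ := h.exists_rightInverse
  filter_upwards [h.eventually_isUnit hR, h.mem_iff.eventually_nhds,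
    h.contDiffAt.eventually (by simp)] with q hu hM hc hq
  refine tangentSpace_eq_ker hq (hc.of_le (by norm_num)) (fun y => ?_) hM
  obtain ⟨u, hu⟩ := hu
  have h1 : (derivPair ρ q ∘L R) ((↑u⁻¹ : F × F →L[ℝ] F × F) (y, 0)) = (y, 0) := by
    rw [← hu, ← mul_apply_eq_comp, Units.mul_inv, one_apply_eq_self]
  exact ⟨_, congrArg Prod.fst h1⟩

theorem tangentSpace_eq (h : IsGenericDefining M p ρ) :
    tangentSpace M p = LinearMap.ker (fderiv ℝ ρ p).toLinearMap :=
  h.eventually_tangentSpace_eq.self_of_nhds h.mem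

theorem eventually_complexify_mem (h : IsGenericDefining M p ρ) :
    ∀ᶠ q in 𝓝[M] p, ∀ a b, complexify a b ∈ holTangent M q ↔
      a ∈ complexKer ρ q ∧ b = -(Complex.I • a) := by
  filter_upwards [nhdsWithin_le_nhds h.eventually_tangentSpace_eq, self_mem_nhdsWithin]
    with q hq hqM a b
  rw [complexify_mem_holTangent, hq hqM, ← and_assoc]
  rfl

theorem complexify_mem_holTangent_iff (h : IsGenericDefining M p ρ) {a b : CSpace N} :
    complexify a b ∈ holTangent M p ↔ a ∈ complexKer ρ p ∧ b = -(Complex.I • a) :=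
  h.eventually_complexify_mem.self_of_nhdsWithin h.mem a b

/-- This trades complex sections for real fields V, with X = V - iJV. The relation between the two
parts is only available along M, not on a neighbourhood in the ambient space. -/
theorem isHolField_iff (h : IsGenericDefining M p ρ) {X : CField N} :
    IsHolField M p X ↔ IsComplexTangentField M p ρ X.re ∧ IsComplexTangentField M p ρ X.im ∧
      ∀ᶠ q in 𝓝[M] p, X.im q = -(Complex.I • X.re q) := by
  have hev : ∀ᶠ q in 𝓝[M] p, X.eval q ∈ holTangent M q ↔
      X.re q ∈ complexKer ρ q ∧ X.im q = -(Complex.I • X.re q) := by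
    filter_upwards [h.eventually_complexify_mem] with q hq using hq _ _
  constructor
  · rintro ⟨h1, h2, h3⟩
    have h4 := hev.and h3
    refine ⟨⟨h1, ?_⟩, ⟨h2, ?_⟩, ?_⟩
    · filter_upwards [h4] with q hq using (hq.1.1 hq.2).1
    · filter_upwards [h4] with q hq
      rw [(hq.1.1 hq.2).2]
      exact neg_mem (I_smul_mem_complexKer (hq.1.1 hq.2).1)
    · filter_upwards [h4] with q hq using (hq.1.1 hq.2).2
  · rintro ⟨h1, h2, h3⟩
    refine ⟨h1.1, h2.1, ?_⟩
    filter_upwards [hev, h1.2, h3] with q hq h4 h5 using hq.2 ⟨h4, h5⟩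

/-- Every complex tangent vector at `p` extends to a complex tangent field. -/
theorem exists_isComplexTangentField (h : IsGenericDefining M p ρ) {v : CSpace N}
    (hv : v ∈ complexKer ρ p) : ∃ V, IsComplexTangentField M p ρ V ∧ V p = v := by
  have : CompleteSpace F := FiniteDimensional.complete ℝ F
  obtain ⟨R, hR⟩ := h.exists_rightInverse
  -- The constant field v is projected onto the kernel of `derivPair` at q along the range of R; at
  -- p the correction vanishes because v is already in the kernel.
  refine ⟨fun q => v - R (Ring.inverse (derivPair ρ q ∘L R) (derivPair ρ q v)), ⟨?_, ?_⟩, ?_⟩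
  · have hK := h.contDiffAt_derivPair
    have hKR : ContDiffAt ℝ 1 (fun q => derivPair ρ q ∘L R) p := hK.clm_comp contDiffAt_const
    have hinv : ContDiffAt ℝ 1 (Ring.inverse : (F × F →L[ℝ] F × F) → _) (derivPair ρ p ∘L R) := by
      rw [hR]
      exact contDiffAt_ringInverse ℝ (1 : (F × F →L[ℝ] F × F)ˣ)
    exact contDiffAt_const.sub (R.contDiff.contDiffAt.comp p
      ((hinv.comp p hKR).clm_apply (hK.clm_apply contDiffAt_const)))
  · refine nhdsWithin_le_nhds ?_
    filter_upwards [h.eventually_isUnit hR] with q hq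
    rw [← derivPair_eq_zero_iff, map_sub, sub_eq_zero]
    have h1 := DFunLike.congr_fun (Ring.mul_inverse_cancel _ hq) (derivPair ρ q v)
    exact h1.symm
  · simp [derivPair_eq_zero_iff.2 hv]

end IsGenericDefining

/-- Differentiating the identity `dρ(W) = 0` along `M`. -/
theorem sndFDeriv_add_eq_zero {M : Set (CSpace N)} {p u : CSpace N} {ρ : CSpace N → F}
    {W : CSpace N → CSpace N} (hp : p ∈ M) (hρ : ContDiffAt ℝ 2 ρ p)
    (hW : DifferentiableAt ℝ W p) (h0 : ∀ᶠ q in 𝓝[M] p, fderiv ℝ ρ q (W q) = 0)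
    (hu : u ∈ tangentSpace M p) :
    fderiv ℝ (fderiv ℝ ρ) p u (W p) + fderiv ℝ ρ p (fderiv ℝ W p u) = 0 := by
  have hD : DifferentiableAt ℝ (fderiv ℝ ρ) p :=
    (hρ.fderiv_right (m := 1) (by norm_num)).differentiableAt one_ne_zero
  have h := fderiv_eq_zero_of_mem_tangentSpace hp (hD.clm_apply hW) h0 hu
  rw [fderiv_clm_apply hD hW] at h
  simpa [add_comm] using h

end Defining
end LeviCR
end

/-! ### Lie brackets, the Levi form, the Levi map and finite type. -/

noncomputable section
namespace LeviCR
section LieBracket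

variable {V : Type*} [NormedAddCommGroup V] [NormedSpace ℝ V]

theorem lieBracket_neg_right (X Y : V → V) (q : V) :
    VectorField.lieBracket ℝ X (fun x => -Y x) q = -VectorField.lieBracket ℝ X Y q := by
  simp only [VectorField.lieBracket, fderiv_fun_neg, neg_apply, map_neg]
  abel

theorem lieBracket_neg_left (X Y : V → V) (q : V) :
    VectorField.lieBracket ℝ (fun x => -X x) Y q = -VectorField.lieBracket ℝ X Y q := by
  simp only [VectorField.lieBracket, fderiv_fun_neg, neg_apply, map_neg]
  abel

end LieBracket

section Levi

variable {N : ℕ} {F : Type*} [NormedAddCommGroup F] [NormedSpace ℝ F]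
  {M : Set (CSpace N)} {p : CSpace N} {ρ : CSpace N → F}

theorem leviForm_I_smul_right (v w : CSpace N) : leviForm ρ p v (Complex.I • w) =
    fderiv ℝ (fderiv ℝ ρ) p v (Complex.I • w) - fderiv ℝ (fderiv ℝ ρ) p (Complex.I • v) w := by
  rw [leviForm_apply, I_smul_I_smul, map_neg, sub_eq_add_neg]

/-- The real span of the values of the Levi form on the complex tangent space. -/
def leviSpan (ρ : CSpace N → F) (p : CSpace N) : Submodule ℝ F :=
  Submodule.span ℝ ((fun v => leviForm ρ p v v) '' complexKer ρ p)

namespace IsComplexTangentField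

theorem neg {V : CSpace N → CSpace N} (h : IsComplexTangentField M p ρ V) :
    IsComplexTangentField M p ρ (fun q => -V q) :=
  ⟨h.1.neg, h.2.mono fun _ hq => neg_mem hq⟩

theorem I_smul {V : CSpace N → CSpace N} (h : IsComplexTangentField M p ρ V) :
    IsComplexTangentField M p ρ (fun q => Complex.I • V q) :=
  ⟨h.1.const_smul Complex.I, h.2.mono fun _ hq => I_smul_mem_complexKer hq⟩

end IsComplexTangentField

namespace IsGenericDefining

theorem mem_complexKer_of_field (h : IsGenericDefining M p ρ) {V : CSpace N → CSpace N}
    (hV : IsComplexTangentField M p ρ V) : V p ∈ complexKer ρ p :=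
  hV.2.self_of_nhdsWithin h.mem

theorem sndFDeriv_comm (h : IsGenericDefining M p ρ) (v w : CSpace N) :
    fderiv ℝ (fderiv ℝ ρ) p v w = fderiv ℝ (fderiv ℝ ρ) p w v :=
  (h.contDiffAt.isSymmSndFDerivAt (by simp)).eq v w

theorem leviForm_comm (h : IsGenericDefining M p ρ) (v w : CSpace N) :
    leviForm ρ p v w = leviForm ρ p w v := by
  rw [leviForm_apply, leviForm_apply, h.sndFDeriv_comm v w, h.sndFDeriv_comm (Complex.I • v)]

/-- Polarization of a symmetric form. -/
theorem leviForm_mem_span (h : IsGenericDefining M p ρ) {v w : CSpace N}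
    (hv : v ∈ complexKer ρ p) (hw : w ∈ complexKer ρ p) : 
    leviForm ρ p v w ∈ leviSpan ρ p := by
  have h1 : leviForm ρ p v w = (1 / 2 : ℝ) •
      (leviForm ρ p (v + w) (v + w) - leviForm ρ p v v - leviForm ρ p w w) := by
    simp only [map_add, LinearMap.add_apply, h.leviForm_comm w v]
    module
  rw [h1]
  refine Submodule.smul_mem _ _ (sub_mem (sub_mem ?_ ?_) ?_)
  · exact Submodule.subset_span ⟨v + w, add_mem hv hw, rfl⟩
  · exact Submodule.subset_span ⟨v, hv, rfl⟩
  · exact Submodule.subset_span ⟨w, hw, rfl⟩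

variable [FiniteDimensional ℝ F]

theorem complexKer_le (h : IsGenericDefining M p ρ) : complexKer ρ p ≤ tangentSpace M p := by
  rw [h.tangentSpace_eq]
  exact inf_le_left

theorem fderiv_fderiv_apply (h : IsGenericDefining M p ρ) {V : CSpace N → CSpace N} {u : CSpace N}
    (hV : IsComplexTangentField M p ρ V) (hu : u ∈ complexKer ρ p) :
    fderiv ℝ ρ p (fderiv ℝ V p u) = -fderiv ℝ (fderiv ℝ ρ) p u (V p) :=
  eq_neg_of_add_eq_zero_right <| sndFDeriv_add_eq_zero h.mem h.contDiffAt
    (hV.1.differentiableAt one_ne_zero) (hV.2.mono fun _ hq => hq.1) (h.complexKer_le hu)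

/-- The previous identity applied to JV, which is again a complex tangent field. -/
theorem fderiv_I_smul_fderiv_apply (h : IsGenericDefining M p ρ) {V : CSpace N → CSpace N}
    {u : CSpace N} (hV : IsComplexTangentField M p ρ V) (hu : u ∈ complexKer ρ p) :
    fderiv ℝ ρ p (Complex.I • fderiv ℝ V p u) =
      -fderiv ℝ (fderiv ℝ ρ) p u (Complex.I • V p) := by
  rw [← h.fderiv_fderiv_apply hV.I_smul hu,
    fderiv_fun_const_smul (hV.1.differentiableAt one_ne_zero)]
  rfl

theorem fderiv_lieBracket (h : IsGenericDefining M p ρ) {V W : CSpace N → CSpace N}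
    (hV : IsComplexTangentField M p ρ V) (hW : IsComplexTangentField M p ρ W) :
    fderiv ℝ ρ p (VectorField.lieBracket ℝ V W p) = 0 := by
  rw [VectorField.lieBracket, map_sub, h.fderiv_fderiv_apply hW (h.mem_complexKer_of_field hV),
    h.fderiv_fderiv_apply hV (h.mem_complexKer_of_field hW), h.sndFDeriv_comm, sub_self]

/-- The central computation: the derivatives of V and W in the bracket are exchanged for second
derivatives of ρ, so only the values of the fields at p remain. -/
theorem fderiv_I_smul_lieBracket (h : IsGenericDefining M p ρ) {V W : CSpace N → CSpace N}
    (hV : IsComplexTangentField M p ρ V) (hW : IsComplexTangentField M p ρ W) :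
    fderiv ℝ ρ p (Complex.I • VectorField.lieBracket ℝ V W p) =
      -leviForm ρ p (V p) (Complex.I • W p) := by
  rw [VectorField.lieBracket, smul_sub, map_sub,
    h.fderiv_I_smul_fderiv_apply hW (h.mem_complexKer_of_field hV),
    h.fderiv_I_smul_fderiv_apply hV (h.mem_complexKer_of_field hW), leviForm_I_smul_right,
    h.sndFDeriv_comm (W p)]
  abel

theorem fderiv_normalProj (h : IsGenericDefining M p ρ) (x : CSpace N) :
    fderiv ℝ ρ p (normalProj M p x) = fderiv ℝ ρ p x := by
  have h1 : x - (normalSpace M p).starProjection x ∈ (normalSpace M p)ᗮ :=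
    Submodule.sub_starProjection_mem_orthogonal x
  have h2 : x - (normalSpace M p).starProjection x ∈ tangentSpace M p := by
    rwa [← Submodule.orthogonal_orthogonal (tangentSpace M p)]
  rw [h.tangentSpace_eq, LinearMap.mem_ker] at h2
  change fderiv ℝ ρ p (x - (normalSpace M p).starProjection x) = 0 at h2
  rw [map_sub, sub_eq_zero] at h2
  exact h2.symm

/-- The derivative of a defining function identifies the normal space with the target. -/
def normalEquiv (h : IsGenericDefining M p ρ) : normalSpace M p ≃ₗ[ℝ] F :=
  LinearEquiv.ofBijective ((fderiv ℝ ρ p).toLinearMap ∘ₗ (normalSpace M p).subtype) (by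
    constructor
    · rw [← LinearMap.ker_eq_bot, LinearMap.ker_eq_bot']
      intro x hx
      have hx1 : (x : CSpace N) ∈ tangentSpace M p := by
        rw [h.tangentSpace_eq]
        exact hx
      have := (Submodule.inf_orthogonal_eq_bot (tangentSpace M p)).le ⟨hx1, x.2⟩
      exact Subtype.ext this
    · intro y
      obtain ⟨v, hv⟩ := h.surjective (y, 0)
      exact ⟨normalProj M p v, (h.fderiv_normalProj v).trans (congrArg Prod.fst hv)⟩)

theorem normalEquiv_apply (h : IsGenericDefining M p ρ) (x : normalSpace M p) :
    h.normalEquiv x = fderiv ℝ ρ p x := rfl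

/-- For X = V + iU, the brackets [V,V] and [U,U] vanish and [X̄,X] = 2i[V,U]. The factor 1/2i then
makes the Levi value real. -/
theorem eval_conj_bracket (X : CField N) :
    (X.conj.bracket X).eval p =
      complexify 0 ((2 : ℝ) • VectorField.lieBracket ℝ X.re X.im p) := by
  rw [CField.eval_eq]
  congr 1
  · change VectorField.lieBracket ℝ X.re X.re p -
      VectorField.lieBracket ℝ (fun q => -X.im q) X.im p = 0
    rw [lieBracket_neg_left]
    simp
  · change VectorField.lieBracket ℝ X.re X.im p +
      VectorField.lieBracket ℝ (fun q => -X.im q) X.re p = _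
    rw [lieBracket_neg_left, VectorField.lieBracket_swap (V := X.im), neg_neg, two_smul]

theorem isLeviValue_iff {Z : CTangent N} {η : normalSpace M p} :
    IsLeviValue M p Z η ↔ ∃ X : CField N, IsHolField M p X ∧ X.eval p = Z ∧
      η = normalProj M p (Complex.I • VectorField.lieBracket ℝ X.re X.im p) := by
  refine exists_congr fun X => and_congr_right fun _ => and_congr_right fun _ => ?_
  have h1 : (1 : ℂ) ⊗ₜ[ℝ] η = complexify η 0 := by simp [complexify]
  have h2 : (1 / (2 * Complex.I)).re = 0 := by simp
  have h3 : (1 / (2 * Complex.I)).im = -(1 / 2) := by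
    simp
  rw [h1, eval_conj_bracket, baseChange_complexify, baseChange_complexify, smul_complexify, h2, h3,
    complexify_inj]
  simp [J_apply, smul_smul]

/-- Taking the imaginary part of the section equal to -JV in the bracket formula turns L(V, JW) into
L(v,v). The outcome does not involve the chosen section, so the Levi value is unique. -/
theorem normalEquiv_of_isLeviValue (h : IsGenericDefining M p ρ) {v w : CSpace N}
    {η : normalSpace M p} (hη : IsLeviValue M p (complexify v w) η) :
    h.normalEquiv η = -leviForm ρ p v v := by
  obtain ⟨X, hX, hXp, rfl⟩ := isLeviValue_iff.1 hη
  obtain ⟨hre, him, hJ⟩ := h.isHolField_iff.1 hX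
  obtain ⟨h1, -⟩ := complexify_inj.1 (hXp : complexify _ _ = _)
  rw [normalEquiv_apply, h.fderiv_normalProj, h.fderiv_I_smul_lieBracket hre him,
    hJ.self_of_nhdsWithin h.mem, smul_neg, I_smul_I_smul, neg_neg, h1]

theorem exists_isHolField (h : IsGenericDefining M p ρ) {v : CSpace N}
    (hv : v ∈ complexKer ρ p) : ∃ X : CField N, IsHolField M p X ∧
      X.re p = v ∧ X.im p = -(Complex.I • v) := by
  obtain ⟨V, hV, hVp⟩ := h.exists_isComplexTangentField hv
  refine ⟨⟨V, fun q => -(Complex.I • V q)⟩, h.isHolField_iff.2 ⟨hV, hV.I_smul.neg, ?_⟩, hVp, ?_⟩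
  · exact Eventually.of_forall fun _ => rfl
  · simp [hVp]

/-- An extension of v to a section provides a Levi value, so the default 0 in `leviMap` is never
used, and uniqueness identifies the chosen value. -/
theorem normalEquiv_leviMap (h : IsGenericDefining M p ρ) (v : CSpace N)
    (Z : holTangent M p) (hZ : (Z : CTangent N) = complexify v (-(Complex.I • v))) :
    h.normalEquiv (leviMap M p Z) = -leviForm ρ p v v := by
  have hv : v ∈ complexKer ρ p := (h.complexify_mem_holTangent_iff.1 (hZ ▸ Z.2)).1
  obtain ⟨X, hX, hre, him⟩ := h.exists_isHolField hv
  have hex : ∃ η, IsLeviValue M p (Z : CTangent N) η :=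
    ⟨_, isLeviValue_iff.2 ⟨X, hX, by rw [hZ, CField.eval_eq, hre, him], rfl⟩⟩
  rw [leviMap, dif_pos hex]
  exact h.normalEquiv_of_isLeviValue (w := -(Complex.I • v))
    (by rw [← hZ]; exact hex.choose_spec)

theorem normalEquiv_image_range_leviMap (h : IsGenericDefining M p ρ) :
    h.normalEquiv '' Set.range (leviMap M p) = (fun v => -leviForm ρ p v v) '' complexKer ρ p := by
  ext y
  constructor
  · rintro ⟨_, ⟨Z, rfl⟩, rfl⟩
    obtain ⟨v, w, hZ⟩ := exists_complexify_eq (Z : CTangent N)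
    obtain ⟨hv, rfl⟩ := h.complexify_mem_holTangent_iff.1 (hZ ▸ Z.2)
    exact ⟨v, hv, (h.normalEquiv_leviMap v Z hZ).symm⟩
  · rintro ⟨v, hv, rfl⟩
    exact ⟨_, ⟨⟨complexify v (-(Complex.I • v)),
      h.complexify_mem_holTangent_iff.2 ⟨hv, rfl⟩⟩, rfl⟩, h.normalEquiv_leviMap v _ rfl⟩

/-- The real tangent vectors at which `dρ ∘ J` lies in the span of the values of the Levi form. -/
def leviTangent (M : Set (CSpace N)) (p : CSpace N) (ρ : CSpace N → F) :
    Submodule ℝ (CSpace N) :=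
  tangentSpace M p ⊓ (leviSpan ρ p).comap
    ((fderiv ℝ ρ p).toLinearMap ∘ₗ J N)

theorem complexKer_le_leviTangent (h : IsGenericDefining M p ρ) :
    complexKer ρ p ≤ leviTangent M p ρ := by
  intro v hv
  refine ⟨h.complexKer_le hv, ?_⟩
  change fderiv ℝ ρ p (Complex.I • v) ∈ leviSpan ρ p
  rw [(mem_complexKer.1 hv).2]
  exact zero_mem _

theorem lieBracket_mem_leviTangent (h : IsGenericDefining M p ρ) {V W : CSpace N → CSpace N}
    (hV : IsComplexTangentField M p ρ V) (hW : IsComplexTangentField M p ρ W) :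
    VectorField.lieBracket ℝ V W p ∈ leviTangent M p ρ := by
  refine ⟨?_, ?_⟩
  · rw [h.tangentSpace_eq]
    exact h.fderiv_lieBracket hV hW
  · change fderiv ℝ ρ p (Complex.I • _) ∈ leviSpan ρ p
    rw [h.fderiv_I_smul_lieBracket hV hW]
    exact neg_mem (h.leviForm_mem_span (h.mem_complexKer_of_field hV)
      (I_smul_mem_complexKer (h.mem_complexKer_of_field hW)))

/-- An upper bound for what the fields and their first brackets can generate; it serves both
directions of the finite type criterion. -/
theorem span_eval_le (h : IsGenericDefining M p ρ) {S : Set (CField N)}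
    (hS : ∀ X ∈ S, IsComplexTangentField M p ρ X.re ∧ IsComplexTangentField M p ρ X.im) :
    Submodule.span ℂ ({Z | ∃ X ∈ S, Z = X.eval p} ∪
      {Z | ∃ X ∈ S, ∃ Y ∈ S, Z = (X.bracket Y).eval p}) ≤ (leviTangent M p ρ).baseChange ℂ := by
  rw [Submodule.span_le]
  rintro _ (⟨X, hX, rfl⟩ | ⟨X, hX, Y, hY, rfl⟩)
  · rw [CField.eval_eq, SetLike.mem_coe, complexify_mem_baseChange]
    exact ⟨h.complexKer_le_leviTangent (h.mem_complexKer_of_field (hS X hX).1),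
      h.complexKer_le_leviTangent (h.mem_complexKer_of_field (hS X hX).2)⟩
  · rw [CField.eval_eq, SetLike.mem_coe, complexify_mem_baseChange]
    exact ⟨sub_mem (h.lieBracket_mem_leviTangent (hS X hX).1 (hS Y hY).1)
        (h.lieBracket_mem_leviTangent (hS X hX).2 (hS Y hY).2),
      add_mem (h.lieBracket_mem_leviTangent (hS X hX).1 (hS Y hY).2)
        (h.lieBracket_mem_leviTangent (hS X hX).2 (hS Y hY).1)⟩

theorem isComplexTangentField_of_mem (h : IsGenericDefining M p ρ) {m : ℕ}
    {L : Fin m → CField N} (hL : ∀ i, IsHolField M p (L i)) :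
    ∀ X ∈ Set.range L ∪ Set.range (fun i => (L i).conj),
      IsComplexTangentField M p ρ X.re ∧ IsComplexTangentField M p ρ X.im := by
  rintro _ (⟨i, rfl⟩ | ⟨i, rfl⟩)
  · exact ⟨(h.isHolField_iff.1 (hL i)).1, (h.isHolField_iff.1 (hL i)).2.1⟩
  · exact ⟨(h.isHolField_iff.1 (hL i)).1, (h.isHolField_iff.1 (hL i)).2.1.neg⟩

/-- Genericity in the form needed for finite type: dρ ∘ J maps the real tangent space onto the
target. -/
theorem exists_mem_tangentSpace (h : IsGenericDefining M p ρ) (y : F) :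
    ∃ t ∈ tangentSpace M p, fderiv ℝ ρ p (Complex.I • t) = y := by
  obtain ⟨t, ht⟩ := h.surjective (0, y)
  refine ⟨t, ?_, congrArg Prod.snd ht⟩
  rw [h.tangentSpace_eq]
  exact congrArg Prod.fst ht

theorem span_leviForm_eq_top_of_isFiniteTypeTwo (h : IsGenericDefining M p ρ)
    (hf : IsFiniteTypeTwo M p) :
    leviSpan ρ p = ⊤ := by
  obtain ⟨m, L, hL, S, rfl, hS⟩ := hf
  have hle := h.span_eval_le (h.isComplexTangentField_of_mem hL)
  rw [hS] at hle
  rw [eq_top_iff]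
  intro y _
  obtain ⟨t, ht, rfl⟩ := h.exists_mem_tangentSpace y
  have h1 : complexify t 0 ∈ (leviTangent M p ρ).baseChange ℂ :=
    hle (complexify_mem_baseChange.2 ⟨ht, zero_mem _⟩)
  exact (complexify_mem_baseChange.1 h1).1.2

theorem isFiniteTypeTwo_of_span_leviForm_eq_top (h : IsGenericDefining M p ρ)
    (hs : leviSpan ρ p = ⊤) :
    IsFiniteTypeTwo M p := by
  set b := Module.finBasis ℝ (complexKer ρ p) with hb
  choose L hL hre him using fun i => h.exists_isHolField (b i).2
  refine ⟨_, L, hL, _, rfl, ?_⟩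
  set S := Set.range L ∪ Set.range (fun i => (L i).conj) with hS
  have hfield := h.isComplexTangentField_of_mem hL
  have hle := (h.span_eval_le hfield).trans (Submodule.baseChange_mono ℂ inf_le_left)
  refine le_antisymm hle ?_
  set Sp := Submodule.span ℂ ({Z | ∃ X ∈ S, Z = X.eval p} ∪
      {Z | ∃ X ∈ S, ∃ Y ∈ S, Z = (X.bracket Y).eval p}) with hSp
  have hmem : ∀ i, L i ∈ S ∧ (L i).conj ∈ S := fun i => ⟨Or.inl ⟨i, rfl⟩, Or.inr ⟨i, rfl⟩⟩
  have hev : ∀ X ∈ S, X.eval p ∈ Sp := fun X hX => Submodule.subset_span (Or.inl ⟨X, hX, rfl⟩)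
  have hbr : ∀ X ∈ S, ∀ Y ∈ S, (X.bracket Y).eval p ∈ Sp := fun X hX Y hY =>
    Submodule.subset_span (Or.inr ⟨X, hX, Y, hY, rfl⟩)
  -- P collects the real vectors in the complex span; the aim is to show that it contains the whole
  -- tangent space.
  set P : Submodule ℝ (CSpace N) :=
    (Sp.restrictScalars ℝ).comap (TensorProduct.mk ℝ ℂ (CSpace N) 1) with hP
  have hPmem : ∀ (c : ℝ) (a : CSpace N), c ≠ 0 → complexify (c • a) 0 ∈ Sp → a ∈ P := by
    intro c a hc ha
    have h1 : c • a ∈ P := by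
      change (1 : ℂ) ⊗ₜ[ℝ] (c • a) ∈ Sp
      simpa [complexify] using ha
    simpa [smul_smul, hc] using P.smul_mem c⁻¹ h1
  have hspan : complexKer ρ p = Submodule.span ℝ (Set.range fun i => (b i : CSpace N)) := by
    have h1 := congrArg (Submodule.map (complexKer ρ p).subtype) b.span_eq
    rw [Submodule.map_top, Submodule.range_subtype, Submodule.map_span, ← Set.range_comp] at h1
    exact h1.symm
  have hker : complexKer ρ p ≤ P := by
    refine hspan.le.trans (Submodule.span_le.2 ?_)
    rintro _ ⟨i, rfl⟩
    -- A section plus its conjugate is twice its real part.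
    refine hPmem 2 _ two_ne_zero ?_
    have h1 := add_mem (hev _ (hmem i).1) (hev _ (hmem i).2)
    rw [CField.eval_eq, CField.eval_eq, complexify_add] at h1
    simpa [CField.conj, hre, two_smul] using h1
  have hbrP : ∀ i j, VectorField.lieBracket ℝ (L i).re (L j).re p ∈ P := by
    intro i j
    -- The four brackets of a field or its conjugate with another or its conjugate add up to [2V_i,
    -- 2V_j] = 4[V_i, V_j].
    refine hPmem 4 _ four_ne_zero ?_
    have h1 := add_mem (add_mem (hbr _ (hmem i).1 _ (hmem j).1) (hbr _ (hmem i).1 _ (hmem j).2))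
      (add_mem (hbr _ (hmem i).2 _ (hmem j).1) (hbr _ (hmem i).2 _ (hmem j).2))
    simp only [CField.eval_eq, complexify_add, CField.conj, CField.bracket, lieBracket_neg_left,
      lieBracket_neg_right] at h1
    convert h1 using 2
    · module
    · abel
  -- The brackets put the Levi form on basis vectors into Q; bilinearity extends this to all complex
  -- tangent vectors, so Q contains `leviSpan`.
  set Q : Submodule ℝ F := P.map ((fderiv ℝ ρ p).toLinearMap ∘ₗ J N) with hQ
  have hQb : ∀ i j, leviForm ρ p (b i) (Complex.I • (b j : CSpace N)) ∈ Q := by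
    intro i j
    have h1 := Submodule.mem_map_of_mem (f := (fderiv ℝ ρ p).toLinearMap ∘ₗ J N) (hbrP i j)
    change fderiv ℝ ρ p (Complex.I • _) ∈ Q at h1
    rw [h.fderiv_I_smul_lieBracket (hfield _ (hmem i).1).1 (hfield _ (hmem j).1).1, hre, hre] at h1
    simpa using h1
  have hQb' : ∀ i, ∀ w ∈ complexKer ρ p, leviForm ρ p (b i) (Complex.I • w) ∈ Q := by
    intro i
    suffices complexKer ρ p ≤ Q.comap (leviForm ρ p (b i) ∘ₗ J N) from fun w hw => this hw
    refine hspan.le.trans (Submodule.span_le.2 ?_)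
    rintro _ ⟨j, rfl⟩
    exact hQb i j
  have hQv : ∀ w ∈ complexKer ρ p, ∀ v ∈ complexKer ρ p,
      leviForm ρ p v (Complex.I • w) ∈ Q := by
    intro w hw
    suffices complexKer ρ p ≤ Q.comap ((leviForm ρ p).flip (Complex.I • w)) from
      fun v hv => this hv
    refine hspan.le.trans (Submodule.span_le.2 ?_)
    rintro _ ⟨i, rfl⟩
    exact hQb' i w hw
  have hQtop : Q = ⊤ := by
    rw [eq_top_iff, ← hs, leviSpan, Submodule.span_le]
    rintro _ ⟨v, hv, rfl⟩
    have h1 := hQv _ (I_smul_mem_complexKer hv) v hv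
    rw [I_smul_I_smul, map_neg] at h1
    simpa using h1
  refine baseChange_le_of_one_tmul_mem fun t ht => ?_
  -- Some s in P has the same image as t under dρ ∘ J; then t - s is complex tangent, hence in P
  -- too.
  obtain ⟨s, hsP, hst⟩ : fderiv ℝ ρ p (Complex.I • t) ∈ Q := hQtop ▸ Submodule.mem_top
  change fderiv ℝ ρ p (Complex.I • s) = fderiv ℝ ρ p (Complex.I • t) at hst
  have hsT : s ∈ tangentSpace M p := by
    have h0 : (1 : ℂ) ⊗ₜ[ℝ] s ∈ Sp := hsP
    have h1 : complexify s 0 ∈ Sp := by simpa [complexify] using h0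
    exact (complexify_mem_baseChange.1 (hle h1)).1
  have hts : t - s ∈ complexKer ρ p := by
    have h1 := sub_mem ht hsT
    rw [h.tangentSpace_eq] at h1
    refine mem_complexKer.2 ⟨h1, ?_⟩
    rw [smul_sub, map_sub, hst, sub_self]
  have h2 := add_mem (hker hts) hsP
  rw [sub_add_cancel] at h2
  exact h2

theorem isFiniteTypeTwo_iff (h : IsGenericDefining M p ρ) : IsFiniteTypeTwo M p ↔
    leviSpan ρ p = ⊤ :=
  ⟨h.span_leviForm_eq_top_of_isFiniteTypeTwo, h.isFiniteTypeTwo_of_span_leviForm_eq_top⟩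

end IsGenericDefining
end Levi
end LeviCR
end

/-! ### Second order expansions and Hermitian values. -/

noncomputable section

theorem isLittleO_of_hasDerivAt_isLittleO {F : Type*} [NormedAddCommGroup F] [NormedSpace ℝ F]
    {g g' : ℝ → F} (hg : ∀ᶠ t in 𝓝 0, HasDerivAt g (g' t) t) (h0 : g 0 = 0)
    (h : g' =o[𝓝 0] fun t => t) : g =o[𝓝 0] fun t : ℝ => t ^ 2 := by
  rw [isLittleO_iff] at h ⊢
  intro c hc
  obtain ⟨ε, hε, H⟩ := Metric.eventually_nhds_iff_ball.1 (hg.and (h hc))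
  filter_upwards [Metric.ball_mem_nhds 0 hε] with t ht
  have hsub : ∀ s ∈ Metric.closedBall (0 : ℝ) |t|, s ∈ Metric.ball (0 : ℝ) ε := fun s hs => by
    rw [mem_closedBall_zero_iff] at hs
    rw [mem_ball_zero_iff] at ht ⊢
    exact hs.trans_lt ht
  have := (convex_closedBall (0 : ℝ) |t|).norm_image_sub_le_of_norm_hasDerivWithin_le
    (C := c * |t|) (fun s hs => (H s (hsub s hs)).1.hasDerivWithinAt)
    (fun s hs => (H s (hsub s hs)).2.trans (by
      rw [mem_closedBall_zero_iff] at hs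
      gcongr))
    (Metric.mem_closedBall_self (abs_nonneg t)) (y := t) (by simp)
  rw [h0, sub_zero, sub_zero] at this
  refine this.trans (le_of_eq ?_)
  rw [norm_pow, Real.norm_eq_abs]
  ring

/-- The second derivative is determined by the second order expansion along a line. -/
theorem sndFDeriv_eq_of_isLittleO {E F : Type*} [NormedAddCommGroup E] [NormedSpace ℝ E]
    [NormedAddCommGroup F] [NormedSpace ℝ F] {f : E → F} (hf : ContDiffAt ℝ 2 f 0) (h0 : f 0 = 0)
    (h1 : fderiv ℝ f 0 = 0) {v : E} {a : F}
    (ha : (fun t : ℝ => f (t • v) - t ^ 2 • a) =o[𝓝 0] fun t : ℝ => t ^ 2) :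
    fderiv ℝ (fderiv ℝ f) 0 v v = (2 : ℝ) • a := by
  set c := fderiv ℝ (fderiv ℝ f) 0 v v with hc
  have hlin : ∀ t : ℝ, HasDerivAt (fun t : ℝ => t • v) v t := fun t => by
    simpa using (hasDerivAt_id t).smul_const v
  have htend : Tendsto (fun t : ℝ => t • v) (𝓝 0) (𝓝 0) := by
    simpa using (hlin 0).continuousAt.tendsto
  have hD : DifferentiableAt ℝ (fderiv ℝ f) 0 :=
    (hf.fderiv_right (m := 1) (by norm_num)).differentiableAt one_ne_zero
  have hd2 : HasDerivAt (fun t : ℝ => fderiv ℝ f (t • v) v) c 0 := by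
    have h2 : HasDerivAt (fun t : ℝ => fderiv ℝ f (t • v)) (fderiv ℝ (fderiv ℝ f) 0 v) 0 :=
      hD.hasFDerivAt.comp_hasDerivAt_of_eq 0 (hlin 0) (by simp)
    simpa using h2.clm_apply (hasDerivAt_const (0 : ℝ) v)
  -- Second order Taylor expansion along the line; comparing it with `ha` and dividing by t²
  -- identifies the coefficients.
  have hsm : (fun t : ℝ => f (t • v) - (t ^ 2 / 2) • c) =o[𝓝 0] fun t : ℝ => t ^ 2 := by
    refine isLittleO_of_hasDerivAt_isLittleO
      (g' := fun t => fderiv ℝ f (t • v) v - t • c) ?_ (by simp [h0]) ?_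
    · have hdf := htend.eventually (hf.eventually (by simp))
      filter_upwards [hdf] with t ht
      have h3 : HasDerivAt (fun t : ℝ => t ^ 2 / 2) t t := by
        simpa using ((hasDerivAt_id t).pow 2).div_const 2
      exact ((ht.differentiableAt two_ne_zero).hasFDerivAt.comp_hasDerivAt t (hlin t)).sub
        (h3.smul_const c)
    · have := hasDerivAt_iff_isLittleO.1 hd2
      simpa [h1] using this
  have hdiff := ha.sub hsm
  have h4 := hdiff.tendsto_inv_smul_nhds_zero
  have h5 : Tendsto (fun _ : ℝ => (1 / 2 : ℝ) • c - a) (𝓝[≠] 0) (𝓝 0) := by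
    refine (h4.mono_left nhdsWithin_le_nhds).congr' ?_
    filter_upwards [self_mem_nhdsWithin] with t ht
    have ht : t ≠ 0 := ht
    have : f (t • v) - t ^ 2 • a - (f (t • v) - (t ^ 2 / 2) • c) =
        t ^ 2 • ((1 / 2 : ℝ) • c - a) := by module
    rw [this, inv_smul_smul₀ (pow_ne_zero 2 ht)]
  have h6 := tendsto_nhds_unique tendsto_const_nhds h5
  rw [← sub_eq_zero.1 h6, smul_smul]
  norm_num

namespace LeviCR
section HermitianValues

variable {n d : ℕ}

/-- The values `(ᵗz̄ A_j z)_j`. -/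
def hermValue (A : Fin d → Matrix (Fin n) (Fin n) ℂ) (z : Fin n → ℂ) : Fin d → ℝ :=
  fun j => (star z ⬝ᵥ (A j *ᵥ z)).re

theorem contDiff_hermValue (A : Fin d → Matrix (Fin n) (Fin n) ℂ) {k : WithTop ℕ∞} :
    ContDiff ℝ k (hermValue A) := by
  refine contDiff_pi.2 fun j => Complex.reCLM.contDiff.comp ?_
  unfold dotProduct Matrix.mulVec dotProduct
  refine ContDiff.sum fun i _ => ContDiff.mul ?_ (ContDiff.sum fun k _ => ?_)
  · exact Complex.conjCLE.contDiff.comp (contDiff_apply ℝ ℂ i)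
  · exact contDiff_const.mul (contDiff_apply ℝ ℂ k)

theorem hermValue_real_smul (A : Fin d → Matrix (Fin n) (Fin n) ℂ) (t : ℝ) (z : Fin n → ℂ) :
    hermValue A (t • z) = t ^ 2 • hermValue A z := by
  ext j
  have h : t • z = (t : ℂ) • z := by ext; simp
  simp only [hermValue, h, star_smul, Matrix.mulVec_smul, smul_dotProduct, dotProduct_smul,
    Pi.smul_apply, smul_eq_mul]
  simp
  ring

/-- This invariance makes the Hermitian contributions to the Levi form add up, whereas the
holomorphic ones cancel. -/
theorem hermValue_I_smul (A : Fin d → Matrix (Fin n) (Fin n) ℂ) (z : Fin n → ℂ) :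
    hermValue A (Complex.I • z) = hermValue A z := by
  ext j
  simp only [hermValue, star_smul, Matrix.mulVec_smul, smul_dotProduct, dotProduct_smul,
    smul_smul]
  simp

theorem hasFDerivAt_hermValue_zero (A : Fin d → Matrix (Fin n) (Fin n) ℂ) :
    HasFDerivAt (hermValue A) (0 : (Fin n → ℂ) →L[ℝ] (Fin d → ℝ)) 0 := by
  have h := (((contDiff_hermValue A (k := 1)).differentiable one_ne_zero) 0).hasFDerivAt
  suffices hz : fderiv ℝ (hermValue A) 0 = 0 by rwa [hz] at h
  ext1 v
  have hlin : HasDerivAt (fun t : ℝ => t • v) v 0 := by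
    simpa using (hasDerivAt_id (0 : ℝ)).smul_const v
  have h1 : HasDerivAt (fun t : ℝ => hermValue A (t • v)) (fderiv ℝ (hermValue A) 0 v) 0 :=
    h.comp_hasDerivAt_of_eq 0 hlin (by simp)
  have h2 : HasDerivAt (fun t : ℝ => hermValue A (t • v)) 0 0 := by
    simp only [hermValue_real_smul]
    simpa using ((hasDerivAt_id (0 : ℝ)).pow 2).smul_const (hermValue A v)
  exact h1.unique h2

end HermitianValues
end LeviCR
end

/-! ### Defining functions from reduced equations and their Levi form. -/

noncomputable section
namespace LeviCR
section Reduced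

variable {n d N : ℕ}

/-- The projection `(z, w) ↦ (z, Re w)`. -/
def rePart (n d : ℕ) : (Fin n → ℂ) × (Fin d → ℂ) →L[ℝ] (Fin n → ℂ) × (Fin d → ℝ) :=
  (ContinuousLinearMap.id ℝ (Fin n → ℂ)).prodMap
    (ContinuousLinearMap.pi fun k => Complex.reCLM ∘L ContinuousLinearMap.proj k)

/-- The projection `(z, w) ↦ Im w`. -/
def imPart (n d : ℕ) : (Fin n → ℂ) × (Fin d → ℂ) →L[ℝ] (Fin d → ℝ) :=
  (ContinuousLinearMap.pi fun k => Complex.imCLM ∘L ContinuousLinearMap.proj k) ∘L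
    ContinuousLinearMap.snd ℝ (Fin n → ℂ) (Fin d → ℂ)

theorem rePart_apply (x : (Fin n → ℂ) × (Fin d → ℂ)) :
    rePart n d x = (x.1, fun k => (x.2 k).re) := rfl

theorem imPart_apply (x : (Fin n → ℂ) × (Fin d → ℂ)) :
    imPart n d x = fun k => (x.2 k).im := rfl

/-- The right-hand side `ᵗz̄ A z + h(z, Re w)` of the reduced equations. -/
def reducedRhs (A : Fin d → Matrix (Fin n) (Fin n) ℂ)
    (h : (Fin n → ℂ) × (Fin d → ℝ) → (Fin d → ℝ)) (x : (Fin n → ℂ) × (Fin d → ℂ)) : Fin d → ℝ :=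
  hermValue A x.1 + h (rePart n d x)

variable {A : Fin d → Matrix (Fin n) (Fin n) ℂ} {h : (Fin n → ℂ) × (Fin d → ℝ) → (Fin d → ℝ)}

theorem contDiffAt_reducedRhs (hc : ContDiffAt ℝ 2 h 0) :
    ContDiffAt ℝ 2 (reducedRhs A h) 0 := by
  refine ((contDiff_hermValue A).contDiffAt.comp _ contDiffAt_fst).add ?_
  refine ContDiffAt.comp _ ?_ (rePart n d).contDiff.contDiffAt
  simpa using hc

theorem isLittleO_id_of_isLittleO_reduced
    (ho : h =o[𝓝 0] fun x : (Fin n → ℂ) × (Fin d → ℝ) => ‖x.1‖ ^ 2 + ‖x.2‖) :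
    h =o[𝓝 0] fun x : (Fin n → ℂ) × (Fin d → ℝ) => x := by
  refine ho.trans_isBigO (IsBigO.of_bound 2 ?_)
  filter_upwards [Metric.ball_mem_nhds (0 : (Fin n → ℂ) × (Fin d → ℝ)) one_pos] with x hx
  rw [mem_ball_zero_iff] at hx
  have h1 : ‖x.1‖ ≤ ‖x‖ := norm_fst_le x
  have h2 : ‖x.2‖ ≤ ‖x‖ := norm_snd_le x
  rw [Real.norm_of_nonneg (by positivity)]
  nlinarith [norm_nonneg x.1]

theorem apply_zero_of_isLittleO_reduced
    (ho : h =o[𝓝 0] fun x : (Fin n → ℂ) × (Fin d → ℝ) => ‖x.1‖ ^ 2 + ‖x.2‖) : h 0 = 0 := by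
  have := (isLittleO_iff.1 ho one_pos).self_of_nhds
  simpa using this

theorem reducedRhs_zero
    (ho : h =o[𝓝 0] fun x : (Fin n → ℂ) × (Fin d → ℝ) => ‖x.1‖ ^ 2 + ‖x.2‖) :
    reducedRhs A h 0 = 0 := by
  have h1 : hermValue A 0 = 0 := by simpa using hermValue_real_smul A 0 0
  rw [reducedRhs, map_zero, apply_zero_of_isLittleO_reduced ho, Prod.fst_zero, h1, add_zero]

theorem hasFDerivAt_reducedRhs_zero
    (ho : h =o[𝓝 0] fun x : (Fin n → ℂ) × (Fin d → ℝ) => ‖x.1‖ ^ 2 + ‖x.2‖) :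
    HasFDerivAt (reducedRhs A h)
      (0 : (Fin n → ℂ) × (Fin d → ℂ) →L[ℝ] (Fin d → ℝ)) 0 := by
  have h1 : HasFDerivAt h (0 : (Fin n → ℂ) × (Fin d → ℝ) →L[ℝ] (Fin d → ℝ)) 0 := by
    rw [hasFDerivAt_iff_isLittleO_nhds_zero]
    simpa [apply_zero_of_isLittleO_reduced ho] using isLittleO_id_of_isLittleO_reduced ho
  have h2 : HasFDerivAt (fun x : (Fin n → ℂ) × (Fin d → ℂ) => hermValue A x.1) _ 0 :=
    HasFDerivAt.comp (𝕜 := ℝ) (0 : (Fin n → ℂ) × (Fin d → ℂ))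
      (g := hermValue A) (f := Prod.fst) (hasFDerivAt_hermValue_zero A) hasFDerivAt_fst
  have h3 : HasFDerivAt (fun x => h (rePart n d x)) _ 0 :=
    HasFDerivAt.comp (0 : (Fin n → ℂ) × (Fin d → ℂ)) (by rwa [map_zero]) (rePart n d).hasFDerivAt
  have h4 := h2.add h3
  rw [ContinuousLinearMap.zero_comp, ContinuousLinearMap.zero_comp, add_zero] at h4
  exact h4

/-- On the line through (z, 0) the coordinate Re w vanishes, so the weighted bound on h becomes
o(t²) and only the Hermitian part is left. -/
theorem sndFDeriv_reducedRhs (hc : ContDiffAt ℝ 2 h 0)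
    (ho : h =o[𝓝 0] fun x : (Fin n → ℂ) × (Fin d → ℝ) => ‖x.1‖ ^ 2 + ‖x.2‖) (z : Fin n → ℂ) :
    fderiv ℝ (fderiv ℝ (reducedRhs A h)) 0 (z, 0) (z, 0) = (2 : ℝ) • hermValue A z := by
  refine sndFDeriv_eq_of_isLittleO (contDiffAt_reducedRhs hc) (reducedRhs_zero ho)
    (hasFDerivAt_reducedRhs_zero ho).fderiv ?_
  have ht : Tendsto (fun t : ℝ => (t • z, (0 : Fin d → ℝ))) (𝓝 0) (𝓝 0) := by
    have : Continuous fun t : ℝ => (t • z, (0 : Fin d → ℝ)) := by fun_prop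
    simpa [Prod.zero_eq_mk] using this.tendsto 0
  have h1 := ho.comp_tendsto ht
  have h2 : (fun t : ℝ => reducedRhs A h (t • (z, 0)) - t ^ 2 • hermValue A z) =
      h ∘ fun t : ℝ => (t • z, (0 : Fin d → ℝ)) := by
    ext1 t
    have h3 : rePart n d (t • (z, 0)) = (t • z, 0) := by
      simp [rePart_apply]
      rfl
    rw [reducedRhs, h3]
    simp [hermValue_real_smul]
  rw [h2]
  refine h1.trans_isBigO (IsBigO.of_bound (‖z‖ ^ 2) (Eventually.of_forall fun t => ?_))
  simp [norm_smul, mul_pow, mul_comm]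

/-- The defining function given by reduced equations in the coordinates `Φ`. -/
def reducedDefining (A : Fin d → Matrix (Fin n) (Fin n) ℂ)
    (h : (Fin n → ℂ) × (Fin d → ℝ) → (Fin d → ℝ))
    (Φ : CSpace N → (Fin n → ℂ) × (Fin d → ℂ)) (q : CSpace N) : Fin d → ℝ :=
  imPart n d (Φ q) - reducedRhs A h (Φ q)

section
variable {Φ : CSpace N → (Fin n → ℂ) × (Fin d → ℂ)} {U : Set (CSpace N)} {p : CSpace N}

theorem contDiffAt_reducedDefining (hU : IsOpen U) (hΦ : DifferentiableOn ℂ Φ U) (hp : p ∈ U)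
    (hΦp : Φ p = 0) (hc : ContDiffAt ℝ 2 h 0) :
    ContDiffAt ℝ 2 (reducedDefining A h Φ) p := by
  have h1 : ContDiffAt ℝ 2 Φ p :=
    ((contDiffOn_of_differentiableOn_complex hU 2 hΦ).contDiffAt (hU.mem_nhds hp)).restrict_scalars ℝ
  refine ((imPart n d).contDiff.contDiffAt.comp p h1).sub
    (ContDiffAt.comp p (g := reducedRhs A h) ?_ h1)
  rw [hΦp]
  exact contDiffAt_reducedRhs hc

theorem eventually_fderiv_reducedDefining (hU : IsOpen U) (hΦ : DifferentiableOn ℂ Φ U)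
    (hp : p ∈ U) (hΦp : Φ p = 0) (hc : ContDiffAt ℝ 2 h 0) :
    ∀ᶠ q in 𝓝 p, ∀ v, fderiv ℝ (reducedDefining A h Φ) q v =
      imPart n d (fderiv ℂ Φ q v) - fderiv ℝ (reducedRhs A h) (Φ q) (fderiv ℂ Φ q v) := by
  have hcont : ContinuousAt Φ p := (hΦ.differentiableAt (hU.mem_nhds hp)).continuousAt
  have h1 : ∀ᶠ q in 𝓝 p, DifferentiableAt ℝ (reducedRhs A h) (Φ q) := by
    refine hcont.eventually ?_
    rw [hΦp]
    exact ((contDiffAt_reducedRhs hc).eventually (by simp)).mono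
      fun x hx => hx.differentiableAt two_ne_zero
  filter_upwards [h1, hU.mem_nhds hp] with q hq hqU v
  have hΦq : HasFDerivAt Φ ((fderiv ℂ Φ q).restrictScalars ℝ) q :=
    (hΦ.differentiableAt (hU.mem_nhds hqU)).hasFDerivAt.restrictScalars ℝ
  have h2 : HasFDerivAt (reducedDefining A h Φ) _ q :=
    ((imPart n d).hasFDerivAt.comp q hΦq).sub (hq.hasFDerivAt.comp q hΦq)
  rw [h2.fderiv]
  rfl

theorem fderiv_reducedDefining (hU : IsOpen U) (hΦ : DifferentiableOn ℂ Φ U) (hp : p ∈ U)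
    (hΦp : Φ p = 0) (hc : ContDiffAt ℝ 2 h 0)
    (ho : h =o[𝓝 0] fun x : (Fin n → ℂ) × (Fin d → ℝ) => ‖x.1‖ ^ 2 + ‖x.2‖) (v : CSpace N) :
    fderiv ℝ (reducedDefining A h Φ) p v = imPart n d (fderiv ℂ Φ p v) := by
  rw [(eventually_fderiv_reducedDefining hU hΦ hp hΦp hc).self_of_nhds v, hΦp,
    (hasFDerivAt_reducedRhs_zero ho).fderiv]
  simp

/-- In the chain rule, the term pairing the first derivative of `reducedRhs` with the second
derivative of Φ drops out, that first derivative being zero at the origin. -/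
theorem sndFDeriv_reducedDefining (hU : IsOpen U) (hΦ : DifferentiableOn ℂ Φ U) (hp : p ∈ U)
    (hΦp : Φ p = 0) (hc : ContDiffAt ℝ 2 h 0)
    (ho : h =o[𝓝 0] fun x : (Fin n → ℂ) × (Fin d → ℝ) => ‖x.1‖ ^ 2 + ‖x.2‖) (v : CSpace N) :
    fderiv ℝ (fderiv ℝ (reducedDefining A h Φ)) p v v =
      imPart n d (fderiv ℂ (fun q => fderiv ℂ Φ q v) p v) -
        fderiv ℝ (fderiv ℝ (reducedRhs A h)) 0 (fderiv ℂ Φ p v) (fderiv ℂ Φ p v) := by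
  have hD : DifferentiableAt ℝ (fderiv ℝ (reducedDefining A h Φ)) p :=
    ((contDiffAt_reducedDefining hU hΦ hp hΦp hc).fderiv_right
      (m := 1) (by norm_num)).differentiableAt one_ne_zero
  have h1 := (hD.hasFDerivAt.clm_apply (hasFDerivAt_const v p)).congr_of_eventuallyEq
    ((eventually_fderiv_reducedDefining (A := A) hU hΦ hp hΦp hc).mono fun q hq => (hq v).symm)
  have hΦp' : HasFDerivAt Φ ((fderiv ℂ Φ p).restrictScalars ℝ) p :=
    (hΦ.differentiableAt (hU.mem_nhds hp)).hasFDerivAt.restrictScalars ℝ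
  have hS : HasFDerivAt (fun q => fderiv ℂ Φ q v)
      ((fderiv ℂ (fun q => fderiv ℂ Φ q v) p).restrictScalars ℝ) p :=
    ((differentiableOn_fderiv_apply hU hΦ v).differentiableAt
      (hU.mem_nhds hp)).hasFDerivAt.restrictScalars ℝ
  have hκ : HasFDerivAt (fderiv ℝ (reducedRhs A h))
      (fderiv ℝ (fderiv ℝ (reducedRhs A h)) 0) (Φ p) := by
    rw [hΦp]
    exact (((contDiffAt_reducedRhs hc).fderiv_right
      (m := 1) (by norm_num)).differentiableAt one_ne_zero).hasFDerivAt
  have h2 := ((imPart n d).hasFDerivAt.comp p hS).sub ((hκ.comp p hΦp').clm_apply hS)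
  have h3 := DFunLike.congr_fun (h1.unique h2) v
  simpa [hΦp, (hasFDerivAt_reducedRhs_zero ho).fderiv] using h3

/-- The second derivative of Φ is complex bilinear, so it changes sign when v becomes Jv and
cancels. Each of the two remaining Hermitian terms contributes a factor -2. -/
theorem leviForm_reducedDefining (hU : IsOpen U) (hΦ : DifferentiableOn ℂ Φ U) (hp : p ∈ U)
    (hΦp : Φ p = 0) (hc : ContDiffAt ℝ 2 h 0)
    (ho : h =o[𝓝 0] fun x : (Fin n → ℂ) × (Fin d → ℝ) => ‖x.1‖ ^ 2 + ‖x.2‖) {v : CSpace N}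
    {z : Fin n → ℂ} (hv : fderiv ℂ Φ p v = (z, 0)) :
    leviForm (reducedDefining A h Φ) p v v = (-4 : ℝ) • hermValue A z := by
  have hd : ∀ v, DifferentiableAt ℂ (fun q => fderiv ℂ Φ q v) p := fun v =>
    (differentiableOn_fderiv_apply hU hΦ v).differentiableAt (hU.mem_nhds hp)
  have hI : fderiv ℂ (fun q => fderiv ℂ Φ q (Complex.I • v)) p (Complex.I • v) =
      -fderiv ℂ (fun q => fderiv ℂ Φ q v) p v := by
    simp only [map_smul]
    rw [fderiv_fun_const_smul (hd v), smul_apply, smul_smul, Complex.I_mul_I, neg_one_smul]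
  have hIv : fderiv ℂ Φ p (Complex.I • v) = (Complex.I • z, 0) := by
    rw [map_smul, hv, Prod.smul_mk, smul_zero]
  rw [leviForm_apply, sndFDeriv_reducedDefining hU hΦ hp hΦp hc ho,
    sndFDeriv_reducedDefining hU hΦ hp hΦp hc ho, hI, hIv, hv, sndFDeriv_reducedRhs hc ho,
    sndFDeriv_reducedRhs hc ho, hermValue_I_smul, map_neg]
  module

theorem mem_complexKer_reducedDefining (hU : IsOpen U) (hΦ : DifferentiableOn ℂ Φ U) (hp : p ∈ U)
    (hΦp : Φ p = 0) (hc : ContDiffAt ℝ 2 h 0)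
    (ho : h =o[𝓝 0] fun x : (Fin n → ℂ) × (Fin d → ℝ) => ‖x.1‖ ^ 2 + ‖x.2‖) {v : CSpace N} :
    v ∈ complexKer (reducedDefining A h Φ) p ↔ (fderiv ℂ Φ p v).2 = 0 := by
  rw [mem_complexKer, fderiv_reducedDefining hU hΦ hp hΦp hc ho,
    fderiv_reducedDefining hU hΦ hp hΦp hc ho, imPart_apply, imPart_apply, map_smul]
  simp only [funext_iff, Complex.ext_iff, Prod.smul_snd, Pi.smul_apply, smul_eq_mul]
  simp only [Complex.mul_im, Complex.I_re, Complex.I_im, zero_mul, one_mul, zero_add,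
    Pi.zero_apply, Complex.zero_re, Complex.zero_im, ← forall_and]
  exact forall_congr' fun _ => and_comm

end

theorem surjective_fderiv_of_isBiholomorphism {E G : Type*} [NormedAddCommGroup E]
    [NormedSpace ℂ E] [NormedAddCommGroup G] [NormedSpace ℂ G] {Φ : OpenPartialHomeomorph E G}
    (hΦ : IsBiholomorphism Φ) {p : E} (hp : p ∈ Φ.source) :
    Function.Surjective (fderiv ℂ Φ p) := by
  have h1 : HasFDerivAt Φ (fderiv ℂ Φ p) (Φ.symm (Φ p)) := by
    rw [Φ.left_inv hp]
    exact (hΦ.1.differentiableAt (Φ.open_source.mem_nhds hp)).hasFDerivAt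
  have h2 : HasFDerivAt Φ.symm (fderiv ℂ Φ.symm (Φ p)) (Φ p) :=
    (hΦ.2.differentiableAt (Φ.open_target.mem_nhds (Φ.map_source hp))).hasFDerivAt
  have h3 : HasFDerivAt (Φ ∘ Φ.symm) (ContinuousLinearMap.id ℂ G) (Φ p) := by
    refine (hasFDerivAt_id (Φ p)).congr_of_eventuallyEq ?_
    filter_upwards [Φ.open_target.mem_nhds (Φ.map_source hp)] with y hy using Φ.right_inv hy
  have h4 := (h1.comp (Φ p) h2).unique h3
  exact fun y => ⟨fderiv ℂ Φ.symm (Φ p) y, DFunLike.congr_fun h4 y⟩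

theorem star_dotProduct_mulVec_eq_re {B : Matrix (Fin n) (Fin n) ℂ} (hB : B.IsHermitian)
    (z : Fin n → ℂ) : star z ⬝ᵥ (B *ᵥ z) = ((star z ⬝ᵥ (B *ᵥ z)).re : ℂ) := by
  have := hB.im_star_dotProduct_mulVec_self z
  apply Complex.ext
  · simp
  · simpa using this

theorem HasReducedEquation.exists_isGenericDefining {M : Set (CSpace N)} {p : CSpace N}
    (hp : p ∈ M) (hA : HasReducedEquation M p A) :
    ∃ ρ : CSpace N → (Fin d → ℝ), IsGenericDefining M p ρ ∧
      (fun v => -leviForm ρ p v v) '' complexKer ρ p =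
        Set.range fun z => (4 : ℝ) • hermValue A z := by
  obtain ⟨hH, Φ, h, hΦ, hpΦ, hΦp, hc, ho, hM⟩ := hA
  have hU := Φ.open_source
  have hs := surjective_fderiv_of_isBiholomorphism hΦ hpΦ
  refine ⟨reducedDefining A h Φ,
    ⟨hp, contDiffAt_reducedDefining hU hΦ.1 hpΦ hΦp hc, ?_, ?_⟩, ?_⟩
  · filter_upwards [hM] with q hq
    rw [hq, reducedDefining, sub_eq_zero, funext_iff]
    refine forall_congr' fun j => ?_
    rw [star_dotProduct_mulVec_eq_re (hH j), ← Complex.ofReal_add, Complex.ofReal_inj]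
    rfl
  · rintro ⟨a, b⟩
    -- For w-component b + ia, dρ reads off the imaginary part a, and dρ ∘ J reads off Im(i(b + ia))
    -- = b.
    obtain ⟨v, hv⟩ := hs (0, fun k => ⟨b k, a k⟩)
    refine ⟨v, ?_⟩
    simp only [fderiv_reducedDefining hU hΦ.1 hpΦ hΦp hc ho, map_smul, hv, imPart_apply]
    ext k <;> simp
  · ext y
    constructor
    · rintro ⟨v, hv, rfl⟩
      have hv2 := (mem_complexKer_reducedDefining hU hΦ.1 hpΦ hΦp hc ho).1 hv
      refine ⟨(fderiv ℂ Φ p v).1, ?_⟩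
      simp only [leviForm_reducedDefining hU hΦ.1 hpΦ hΦp hc ho (Prod.ext rfl hv2)]
      module
    · rintro ⟨z, rfl⟩
      obtain ⟨v, hv⟩ := hs (z, 0)
      refine ⟨v, (mem_complexKer_reducedDefining hU hΦ.1 hpΦ hΦp hc ho).2 (by rw [hv]), ?_⟩
      simp only [leviForm_reducedDefining hU hΦ.1 hpΦ hΦp hc ho hv]
      module

end Reduced
end LeviCR
end

/-! ### Linear independence and spanning. -/

noncomputable section
namespace LeviCR
section LinearAlgebra

variable {n d : ℕ}

/-- Complex polarization, from the values at z + w and z + iw; B need not be Hermitian. -/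
theorem matrix_eq_zero_of_star_dotProduct_mulVec_eq_zero {B : Matrix (Fin n) (Fin n) ℂ}
    (hB : ∀ z, star z ⬝ᵥ (B *ᵥ z) = 0) : B = 0 := by
  have h1 : ∀ z w, star z ⬝ᵥ (B *ᵥ w) = 0 := by
    intro z w
    have h2 := hB (z + w)
    have h3 := hB (z + Complex.I • w)
    simp only [star_add, Matrix.mulVec_add, add_dotProduct, dotProduct_add, star_smul,
      Matrix.mulVec_smul, smul_dotProduct, dotProduct_smul, hB z, hB w, zero_add,
      add_zero, smul_eq_mul, Complex.star_def, Complex.conj_I] at h2 h3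
    linear_combination (1 / 2 : ℂ) * h2 - (Complex.I / 2) * h3 +
      (1 / 2) * (star z ⬝ᵥ B *ᵥ w - star w ⬝ᵥ B *ᵥ z) * Complex.I_sq
  ext i j
  simpa [← Pi.single_star] using h1 (Pi.single i 1) (Pi.single j 1)

variable {A : Fin d → Matrix (Fin n) (Fin n) ℂ}

theorem sum_mul_hermValue (g : Fin d → ℝ) (z : Fin n → ℂ) :
    ∑ j, g j * hermValue A z j = (star z ⬝ᵥ ((∑ j, g j • A j) *ᵥ z)).re := by
  rw [Matrix.sum_mulVec, dotProduct_sum, Complex.re_sum]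
  refine Finset.sum_congr rfl fun j _ => ?_
  rw [Matrix.smul_mulVec, dotProduct_smul]
  simp [hermValue]

/-- The values of Hermitian forms span iff the forms are linearly independent. -/
theorem span_range_hermValue_eq_top_iff (hA : ∀ j, (A j).IsHermitian) :
    Submodule.span ℝ (Set.range fun z => (4 : ℝ) • hermValue A z) = ⊤ ↔
      LinearIndependent ℝ A := by
  rw [Fintype.linearIndependent_iff]
  constructor
  · intro hs g hg i
    have hle : Submodule.span ℝ (Set.range fun z => (4 : ℝ) • hermValue A z) ≤
        LinearMap.ker (Fintype.linearCombination ℝ g) := by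
      rw [Submodule.span_le]
      rintro _ ⟨z, rfl⟩
      have h1 := sum_mul_hermValue (A := A) g z
      rw [hg] at h1
      rw [SetLike.mem_coe, LinearMap.mem_ker, map_smul, Fintype.linearCombination_apply]
      simp only [smul_eq_mul, mul_comm _ (g _), h1]
      simp
    rw [hs] at hle
    have h2 : Fintype.linearCombination ℝ g (Pi.single i 1) = 0 := hle Submodule.mem_top
    simpa using h2
  · intro hli
    by_contra hne
    -- A nonzero functional killing a proper span supplies, through its values on the standard
    -- basis, a nontrivial real relation among the matrices.
    obtain ⟨f, hf0, hf⟩ := Submodule.exists_le_ker_of_lt_top _ (lt_top_iff_ne_top.2 hne)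
    refine hf0 (LinearMap.pi_ext' fun i => LinearMap.ext_ring ?_)
    change f (Pi.single i 1) = 0
    refine hli (fun j => f (Pi.single j 1)) ?_ i
    refine matrix_eq_zero_of_star_dotProduct_mulVec_eq_zero fun z => ?_
    have hB : (∑ j, f (Pi.single j 1) • A j).IsHermitian := by
      rw [Matrix.IsHermitian, Matrix.conjTranspose_sum]
      refine Finset.sum_congr rfl fun j _ => ?_
      rw [Matrix.conjTranspose_smul, (hA j).eq, star_trivial]
    rw [star_dotProduct_mulVec_eq_re hB, ← sum_mul_hermValue]
    have h1 : f ((4 : ℝ) • hermValue A z) = 0 := hf (Submodule.subset_span ⟨z, rfl⟩)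
    rw [map_smul, smul_eq_zero, or_iff_right four_ne_zero] at h1
    have h2 : f (hermValue A z) = ∑ j, f (Pi.single j 1) * hermValue A z j := by
      conv_lhs => rw [pi_eq_sum_univ' (hermValue A z)]
      simp only [map_sum, map_smul, smul_eq_mul, mul_comm]
    rw [← h2, h1, Complex.ofReal_zero]

/-- The adjoint of a complex relation is the relation with conjugate coefficients, so the real and
imaginary parts of the coefficients give real relations. -/
theorem linearIndependent_complex_iff (hA : ∀ j, (A j).IsHermitian) :
    LinearIndependent ℂ A ↔ LinearIndependent ℝ A := by
  refine ⟨fun h => h.restrict_scalars' ℝ, fun h => ?_⟩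
  rw [Fintype.linearIndependent_iff] at h ⊢
  intro g hg
  have hg' : ∑ j, star (g j) • A j = 0 := by
    have := congrArg Matrix.conjTranspose hg
    simpa [Matrix.conjTranspose_sum, Matrix.conjTranspose_smul, fun j => (hA j).eq] using this
  have hre : ∑ j, (g j).re • A j = 0 := by
    have h1 : ∑ j, (g j).re • A j = (1 / 2 : ℂ) • (∑ j, g j • A j + ∑ j, star (g j) • A j) := by
      rw [← Finset.sum_add_distrib, Finset.smul_sum]
      refine Finset.sum_congr rfl fun j _ => ?_
      rw [← add_smul, smul_smul, ← Complex.coe_smul]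
      congr 1
      rw [Complex.re_eq_add_conj, Complex.star_def]
      ring
    rw [h1, hg, hg', add_zero, smul_zero]
  have him : ∑ j, (g j).im • A j = 0 := by
    have h1 : ∑ j, (g j).im • A j =
        (1 / (2 * Complex.I) : ℂ) • (∑ j, g j • A j - ∑ j, star (g j) • A j) := by
      rw [← Finset.sum_sub_distrib, Finset.smul_sum]
      refine Finset.sum_congr rfl fun j _ => ?_
      rw [← sub_smul, smul_smul, ← Complex.coe_smul]
      congr 1
      rw [Complex.im_eq_sub_conj, Complex.star_def]
      ring
    rw [h1, hg, hg', sub_zero, smul_zero]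
  exact fun i => Complex.ext (h _ hre i) (h _ him i)

theorem span_eq_top_iff_not_exists_isCoatom {V : Type*} [AddCommGroup V] [Module ℝ V]
    [FiniteDimensional ℝ V] (s : Set V) : Submodule.span ℝ s = ⊤ ↔
      ¬ ∃ H : Submodule ℝ V, IsCoatom H ∧ s ⊆ (H : Set V) := by
  constructor
  · rintro hs ⟨H, hH, hsH⟩
    exact hH.1 (top_le_iff.1 (hs ▸ Submodule.span_le.2 hsH))
  · intro hs
    refine (eq_top_or_exists_le_coatom (Submodule.span ℝ s)).resolve_right ?_
    rintro ⟨H, hH, hle⟩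
    exact hs ⟨H, hH, Submodule.span_le.1 hle⟩

theorem span_eq_top_iff_interior_span {V : Type*} [NormedAddCommGroup V] [NormedSpace ℝ V]
    (s : Set V) : Submodule.span ℝ s = ⊤ ↔
      (interior (Submodule.span ℝ s : Set V)).Nonempty := by
  refine ⟨fun hs => ?_, fun hs => Submodule.eq_top_of_nonempty_interior' _ hs⟩
  rw [hs, Submodule.top_coe, interior_univ]
  exact Set.univ_nonempty

/-- A convex hull has interior iff the affine span is everything; as 0 belongs to the set, the
affine span is the linear span. -/
theorem span_eq_top_iff_interior_convexHull {V : Type*} [NormedAddCommGroup V] [NormedSpace ℝ V]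
    [FiniteDimensional ℝ V] {s : Set V} (h0 : (0 : V) ∈ s) : Submodule.span ℝ s = ⊤ ↔
      (interior (convexHull ℝ s)).Nonempty := by
  rw [interior_convexHull_nonempty_iff_affineSpan_eq_top,
    AffineSubspace.affineSpan_eq_top_iff_vectorSpan_eq_top_of_nonempty ℝ V V ⟨0, h0⟩,
    vectorSpan_eq_span_vsub_set_right ℝ h0]
  simp

end LinearAlgebra

/-! ### The equivalences and biholomorphic invariance. -/

section Main

variable {n d N : ℕ} {M : Set (CSpace N)} {p : CSpace N} {A : Fin d → Matrix (Fin n) (Fin n) ℂ}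

theorem HasReducedEquation.span_leviMap_and_isFiniteTypeTwo (hp : p ∈ M)
    (hA : HasReducedEquation M p A) :
    (Submodule.span ℝ (Set.range (leviMap M p)) = ⊤ ↔ LinearIndependent ℝ A) ∧
      (IsFiniteTypeTwo M p ↔ LinearIndependent ℝ A) ∧ 0 ∈ Set.range (leviMap M p) := by
  obtain ⟨ρ, hρ, himg⟩ := hA.exists_isGenericDefining hp
  have hrange := hρ.normalEquiv_image_range_leviMap
  refine ⟨?_, ?_, ?_⟩
  · rw [← span_range_hermValue_eq_top_iff hA.1, ← himg, ← hrange]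
    have h1 : Submodule.span ℝ (hρ.normalEquiv '' Set.range (leviMap M p)) =
        (Submodule.span ℝ (Set.range (leviMap M p))).map hρ.normalEquiv.toLinearMap :=
      (Submodule.map_span hρ.normalEquiv.toLinearMap _).symm
    rw [h1]
    constructor
    · intro h
      rw [h, Submodule.map_top, LinearEquiv.range]
    · intro h
      exact Submodule.map_injective_of_injective hρ.normalEquiv.injective
        (by rw [h, Submodule.map_top, LinearEquiv.range])
  · rw [← span_range_hermValue_eq_top_iff hA.1, ← himg, hρ.isFiniteTypeTwo_iff, leviSpan,
      ← Submodule.span_neg ((fun v => -leviForm ρ p v v) '' _), ← Set.image_neg_eq_neg,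
      Set.image_image]
    simp only [neg_neg]
  · have h0 : (0 : Fin d → ℝ) ∈ hρ.normalEquiv '' Set.range (leviMap M p) := by
      rw [hrange]
      exact ⟨0, zero_mem _, by simp⟩
    obtain ⟨x, hx, hx0⟩ := h0
    rwa [(LinearEquiv.map_eq_zero_iff _).1 hx0] at hx

/-- Reduced equations pull back under biholomorphisms. -/
theorem HasReducedEquation.comap {M' : Set (CSpace N)}
    {Ψ : OpenPartialHomeomorph (CSpace N) (CSpace N)} (hΨ : IsBiholomorphism Ψ)
    (hp : p ∈ Ψ.source) (hM : ∀ᶠ q in 𝓝 p, (q ∈ M ↔ Ψ q ∈ M'))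
    (hA : HasReducedEquation M' (Ψ p) A) : HasReducedEquation M p A := by
  obtain ⟨hH, Φ, h, hΦ, hpΦ, hΦp, hc, ho, hM'⟩ := hA
  refine ⟨hH, Ψ.trans Φ, h, ⟨?_, ?_⟩, ?_, hΦp, hc, ho, ?_⟩
  · rw [OpenPartialHomeomorph.trans_source]
    exact hΦ.1.comp (hΨ.1.mono Set.inter_subset_left) fun x hx => hx.2
  · rw [OpenPartialHomeomorph.trans_target]
    exact hΨ.2.comp (hΦ.2.mono Set.inter_subset_left) fun x hx => hx.2
  · rw [OpenPartialHomeomorph.trans_source]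
    exact ⟨hp, hpΦ⟩
  · filter_upwards [hM, (Ψ.continuousAt hp).eventually hM'] with q hq hq'
    exact hq.trans hq'

end Main
end LeviCR
end

theorem mainTheorem3 (n d : ℕ) (hn : 1 ≤ n) (hd : 1 ≤ d)
    (M : Set (LeviCR.CSpace (n + d)))
    (hM : LeviCR.IsC2Submanifold d M) (hgen : LeviCR.IsGeneric M)
    (p : LeviCR.CSpace (n + d)) (hp : p ∈ M)
    (A : Fin d → Matrix (Fin n) (Fin n) ℂ) (hA : LeviCR.HasReducedEquation M p A) :
    List.TFAE [
      LinearIndependent ℝ A,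
      LinearIndependent ℂ A,
      ¬ ∃ H : Submodule ℝ (LeviCR.normalSpace M p),
        IsCoatom H ∧ Set.range (LeviCR.leviMap M p) ⊆ (H : Set (LeviCR.normalSpace M p)),
      (interior (convexHull ℝ (Set.range (LeviCR.leviMap M p)))).Nonempty,
      (interior (Submodule.span ℝ (Set.range (LeviCR.leviMap M p)) :
        Set (LeviCR.normalSpace M p))).Nonempty,
      LeviCR.IsFiniteTypeTwo M p] ∧
    ∀ (M' : Set (LeviCR.CSpace (n + d))),
      LeviCR.IsC2Submanifold d M' → LeviCR.IsGeneric M' →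
      ∀ (F : OpenPartialHomeomorph (LeviCR.CSpace (n + d)) (LeviCR.CSpace (n + d))),
        LeviCR.IsBiholomorphism F → p ∈ F.source → (∀ᶠ q in 𝓝 p, (q ∈ M ↔ F q ∈ M')) →
        ∀ A' : Fin d → Matrix (Fin n) (Fin n) ℂ, LeviCR.HasReducedEquation M' (F p) A' →
          (LinearIndependent ℝ A ↔ LinearIndependent ℝ A') := by
  obtain ⟨hspan, htype, h0⟩ := hA.span_leviMap_and_isFiniteTypeTwo hp
  constructor
  · rw [← LeviCR.span_eq_top_iff_not_exists_isCoatom,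
      ← LeviCR.span_eq_top_iff_interior_convexHull h0, ← LeviCR.span_eq_top_iff_interior_span,
      LeviCR.linearIndependent_complex_iff hA.1, hspan, htype]
    simp only [List.TFAE, List.mem_cons, List.not_mem_nil, or_false]
    aesop
  · intro M' _ _ F hF hpF hMM' A' hA'
    -- Pulled back by F, the matrices A' belong to reduced equations of M at p, so both independence
    -- conditions amount to spanning by the same Levi map.
    rw [← hspan, ((hA'.comap hF hpF hMM').span_leviMap_and_isFiniteTypeTwo hp).1]
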